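/- Let $a>-1$ be a fixed real number and $w(x)=x^{a}e^{-x}$ for $x>0$, $w(x)=0$ for $x\le 0$. For $N\ge 0$ consider the Laguerre unitary ensemble of $N$ eigenvalues, with joint density $$P_N(\lambda_1,\dots,\lambda_N)=\frac1{C_N}\prod_{l=1}^N w(\lambda_l)\prod_{1\le j<l\le N}|\lambda_l-\lambda_j|^2$$ on $\mathbb R^N$, where $C_N$ is the integral over $\mathbb R^N$ of the product on the right, and write $\langle F\rangle=\int_{\mathbb R^N}F\,P_N\,d\lambda$. For every $N$, $P_N$ is a probability density (non-negative, integrable, with integral $1$). For real $k$ define the structure function $$S_N^{(L)}(k)=\Big\langle\Big|\sum_{j=1}^N e^{ik\lambda_j}\Big|^2\Big\rangle-\Big|\Big\langle\sum_{j=1}^N e^{ik\lambda_j}\Big\rangle\Big|^2 .$$ Then for every $k\ge 0$ the limit $S_\infty^{(L)}(k)=\lim_{N\to\infty}\frac1N S_N^{(L)}(k)$ exists, and $$S_\infty^{(L)}(k)=\frac2\pi\operatorname{Arctan}k .$$ In particular there is no ramp-plateau transition: $S_\infty^{(L)}$ is real analytic on $(0,\infty)$, and $S_\infty^{(L)}(k)<1$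 for every $k\ge0$, so the plateau value $1$ is never attained. -/

import Mathlib

open MeasureTheory Filter Topology

noncomputable section

namespace RandomMatrix

/-- The Laguerre weight `x ^ a * e ^ (-x)` on `x > 0`, and `0` elsewhere. -/
def laguerreWeight (a x : ℝ) : ℝ :=
  if 0 < x then x ^ a * Real.exp (-x) else 0

/-- The unnormalised joint eigenvalue density with weight `w` and unitary symmetry (`β = 2`),
`∏ l, w (x l) * ∏ j < k, |x k - x j| ^ 2`. -/
def unnormalizedDensity (w : ℝ → ℝ) (N : ℕ) (x : Fin N → ℝ) : ℝ :=
  (∏ l, w (x l)) * ∏ j, ∏ k ∈ Finset.Ioi j, |x k - x j| ^ 2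

/-- The normalisation constant `C_N`. -/
def normalizationConstant (w : ℝ → ℝ) (N : ℕ) : ℝ :=
  ∫ x : Fin N → ℝ, unnormalizedDensity w N x

/-- The joint eigenvalue probability density function `P_N`. -/
def jointDensity (w : ℝ → ℝ) (N : ℕ) (x : Fin N → ℝ) : ℝ :=
  (1 / normalizationConstant w N) * unnormalizedDensity w N x

/-- The ensemble average `⟨F⟩` of a real or complex function `F` of the eigenvalues. -/
def ensembleAverage {E : Type*} [NormedAddCommGroup E] [NormedSpace ℝ E]
    (w : ℝ → ℝ) (N : ℕ) (F : (Fin N → ℝ) → E) : E :=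
  ∫ x : Fin N → ℝ, jointDensity w N x • F x

/-- The linear statistic `∑ j, e ^ (i k x j)`. -/
def exponentialStatistic (k : ℝ) {N : ℕ} (x : Fin N → ℝ) : ℂ :=
  ∑ j, Complex.exp (Complex.I * (k : ℂ) * (x j : ℂ))

/-- The structure function
`S_N(k) = ⟨|∑ j, e ^ (i k x j)| ^ 2⟩ - |⟨∑ j, e ^ (i k x j)⟩| ^ 2`. -/
def structureFunction (w : ℝ → ℝ) (N : ℕ) (k : ℝ) : ℝ :=
  ensembleAverage w N (fun x => ‖exponentialStatistic k x‖ ^ 2)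
    - ‖ensembleAverage w N (fun x => exponentialStatistic k x)‖ ^ 2

end RandomMatrix

end

/-!
The Laguerre ensemble is determinantal. Expanding the squared Vandermonde determinant in the
orthonormal Laguerre polynomials gives the normalisation, and expresses the structure function by
the matrix `U m n` of the multiplication by `e ^ (i k x)` in these polynomials:
`S_N(k) = N - ∑_{m, n < N} |U m n| ^ 2` (`structureFunction_laguerre`). As `U` is symmetric, the
increment in `N` is `1` minus the masses `∑_{n < N} |U N n| ^ 2` and `∑_{n ≤ N} |U N n| ^ 2`, so
that, by Cesàro, the limits of these two masses determine the limit of `S_N(k) / N`.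

Since `U` is unitary, the `m`-th row gives a probability measure with mass `|U m n| ^ 2` at `n / m`
(`rowLaw`). Unitarity (`hasSum_waveElement_mul_conj`) holds because `e ^ (i k x) p`, for a polynomial
`p`, lies in the closure of the polynomials in the Hilbert space of the weight; for small `k` this is
the dominated convergence of the Taylor series, and short steps reach all `k`
(`innerWave_add_eq_zero`).

The polynomials are eigenfunctions of the Laguerre operator with eigenvalue `n`, and the
multiplication by `e ^ (i k x)` conjugates this operator to a tridiagonal one, quadratic in `k`
(`IsGammaFunctional.natCast_mul_apply`, from integration by parts). The moments of the rows are thus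
diagonal entries of powers of a tridiagonal matrix whose entries grow linearly. In the limit they
become the moments of `1 + 2 k ^ 2 + 2 k √(1 + k ^ 2) cos θ` for a uniform phase `θ`
(`tendsto_rowMoment`). This limit law has compact support, so convergence of moments implies weak
convergence (`tendsto_probabilityMeasure_of_tendsto_moments`). For `k > 0` it has no atom at `1`, and
its mass below `1` is `1 / 2 - arctan k / π`, whence the limit
`1 - 2 (1 / 2 - arctan k / π) = (2 / π) arctan k`.
-/

/-! ### Monic Laguerre polynomials -/

namespace RandomMatrix

open Polynomial in
/-- The monic Laguerre polynomials `(-1) ^ n * n! * L_n ^ (a)`, defined through their three term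
recurrence. -/
noncomputable def monicLaguerre (a : ℝ) : ℕ → ℝ[X]
  | 0 => 1
  | 1 => X - C (a + 1)
  | n + 2 => (X - C (2 * n + a + 3)) * monicLaguerre a (n + 1)
      - C ((n + 1) * (n + 1 + a)) * monicLaguerre a n

section Polynomials

open Polynomial

variable (a : ℝ)

lemma monicLaguerre_add_two (n : ℕ) : monicLaguerre a (n + 2) =
    (X - C (2 * n + a + 3)) * monicLaguerre a (n + 1)
      - C ((n + 1) * (n + 1 + a)) * monicLaguerre a n := by
  rw [monicLaguerre]

/-- The three term recurrence in a form that also covers `n = 0`; the value of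
`monicLaguerre a (0 - 1)` does not matter, since its coefficient vanishes. -/
lemma X_mul_monicLaguerre (n : ℕ) : X * monicLaguerre a n =
    monicLaguerre a (n + 1) + C (2 * n + a + 1) * monicLaguerre a n
      + C (n * (n + a)) * monicLaguerre a (n - 1) := by
  cases n with
  | zero => simp [monicLaguerre]
  | succ n =>
    rw [monicLaguerre_add_two, Nat.add_sub_cancel]
    push_cast
    simp only [C_add, C_mul, C_1, C_ofNat]
    ring

lemma degree_monicLaguerre_and_monic (n : ℕ) :
    (monicLaguerre a n).natDegree = n ∧ (monicLaguerre a n).Monic := by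
  induction n using Nat.strong_induction_on with
  | _ n ih =>
    match n, ih with
    | 0, _ => simp [monicLaguerre]
    | 1, _ => exact ⟨by rw [monicLaguerre]; exact natDegree_X_sub_C _,
        by rw [monicLaguerre]; exact monic_X_sub_C _⟩
    | n + 2, ih =>
      obtain ⟨d1, m1⟩ := ih (n + 1) (by omega)
      obtain ⟨d0, m0⟩ := ih n (by omega)
      set c : ℝ := (n + 1) * (n + 1 + a)
      have hm : ((X - C (2 * n + a + 3)) * monicLaguerre a (n + 1)).Monic :=
        (monic_X_sub_C _).mul m1
      have hd : ((X - C (2 * n + a + 3)) * monicLaguerre a (n + 1)).natDegree = n + 2 := by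
        rw [(monic_X_sub_C _).natDegree_mul m1, d1, natDegree_X_sub_C]; omega
      have hlt : (C c * monicLaguerre a n).natDegree <
          ((X - C (2 * n + a + 3)) * monicLaguerre a (n + 1)).natDegree := by
        rw [hd]
        exact lt_of_le_of_lt (natDegree_C_mul_le _ _) (by omega)
      have hdeg : (C c * monicLaguerre a n).degree <
          ((X - C (2 * n + a + 3)) * monicLaguerre a (n + 1)).degree := by
        rw [degree_eq_natDegree hm.ne_zero, hd]
        refine lt_of_le_of_lt (degree_le_natDegree) ?_
        rw [hd] at hlt
        exact_mod_cast hlt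
      rw [monicLaguerre_add_two]
      exact ⟨by rw [natDegree_sub_eq_left_of_natDegree_lt hlt, hd], hm.sub_of_left hdeg⟩

lemma X_mul_derivative_monicLaguerre (n : ℕ) : X * derivative (monicLaguerre a n) =
    C (n : ℝ) * monicLaguerre a n + C (n * (n + a)) * monicLaguerre a (n - 1) := by
  induction n using Nat.strong_induction_on with
  | _ n ih =>
    match n, ih with
    | 0, _ => simp [monicLaguerre]
    | 1, _ => simp [monicLaguerre]; ring
    | n + 2, ih =>
      have h1 := ih (n + 1) (by omega)
      have h0 := ih n (by omega)
      have r0 := X_mul_monicLaguerre a n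
      rw [monicLaguerre_add_two]
      simp only [derivative_sub, derivative_mul, derivative_X, derivative_C, Nat.add_sub_cancel,
        show n + 2 - 1 = n + 1 by omega] at h1 ⊢
      push_cast at h1 h0 r0 ⊢
      simp only [C_add, C_mul, C_1, C_ofNat] at h1 h0 r0 ⊢
      linear_combination (X - (2 * C (n : ℝ) + C a + 3)) * h1
        - (C (n : ℝ) + 1) * (C (n : ℝ) + 1 + C a) * h0
        + (C (n : ℝ) + 1) * (C (n : ℝ) + 1 + C a) * r0

/-- The derivative form of the contiguity relation, obtained by cancelling a factor `X`. -/
lemma derivative_monicLaguerre_succ (n : ℕ) : derivative (monicLaguerre a (n + 1)) =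
    C ((n : ℝ) + 1) * (monicLaguerre a n - derivative (monicLaguerre a n)) := by
  have h1 := X_mul_derivative_monicLaguerre a (n + 1)
  have h0 := X_mul_derivative_monicLaguerre a n
  have r0 := X_mul_monicLaguerre a n
  refine mul_left_cancel₀ (X_ne_zero (R := ℝ)) ?_
  simp only [Nat.add_sub_cancel] at h1
  push_cast at h1 h0 r0 ⊢
  simp only [C_add, C_mul, C_1, C_ofNat] at h1 h0 r0 ⊢
  linear_combination h1 + (C (n : ℝ) + 1) * h0 - (C (n : ℝ) + 1) * r0

/-- Laguerre's differential equation. -/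
lemma monicLaguerre_differential_equation (n : ℕ) :
    X * derivative (derivative (monicLaguerre a n)) + C (a + 1) * derivative (monicLaguerre a n) =
      X * derivative (monicLaguerre a n) - C (n : ℝ) * monicLaguerre a n := by
  cases n with
  | zero => simp [monicLaguerre]
  | succ n =>
    have h1 := X_mul_derivative_monicLaguerre a (n + 1)
    have hd := congrArg derivative h1
    have e := derivative_monicLaguerre_succ a n
    simp only [derivative_mul, derivative_X, derivative_C, derivative_add,
      Nat.add_sub_cancel] at hd h1
    push_cast at *
    simp only [C_add, C_mul, C_1] at *
    linear_combination hd - h1 + (C (n : ℝ) + 1 + C a) * e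

/-- A linear functional on polynomials that behaves like `f ↦ ∫ f x * e ^ (-z x) * x ^ a` on the
half-line under integration by parts. -/
def IsGammaFunctional (a : ℝ) (z : ℂ) (L : ℝ[X] →ₗ[ℝ] ℂ) : Prop :=
  ∀ f : ℝ[X], L (X * derivative f + C (a + 1) * f) = z * L (X * f)

/-- The multiplication by `e ^ (i k x)` conjugates the Laguerre operator, which has the eigenvalue `n`
on the `n`-th polynomial, to a tridiagonal operator with the diagonal entries
`m + k ^ 2 (2 m + a + 1)`. -/
lemma IsGammaFunctional.natCast_mul_apply {a k : ℝ} {L : ℝ[X] →ₗ[ℝ] ℂ}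
    (hL : IsGammaFunctional a (1 - Complex.I * k) L) (m n : ℕ) :
    (n : ℂ) * L (monicLaguerre a m * monicLaguerre a n) =
      (m + k ^ 2 * (2 * m + a + 1)) * L (monicLaguerre a m * monicLaguerre a n)
      + (k ^ 2 + Complex.I * k) * L (monicLaguerre a (m + 1) * monicLaguerre a n)
      + (k ^ 2 - Complex.I * k) * (m * (m + a)) *
        L (monicLaguerre a (m - 1) * monicLaguerre a n) := by
  have smulC (c : ℝ) (p : ℝ[X]) : L (C c * p) = (c : ℂ) * L p := by
    rw [← smul_eq_C_mul, map_smul, Complex.real_smul]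
  set q := monicLaguerre a m with hq
  set p := monicLaguerre a n with hp
  -- `L (x q' p')` is computed by parts in two ways
  have e1 := hL (q * derivative p)
  have e2 := hL (p * derivative q)
  have e3 := hL (q * p)
  have o1 := monicLaguerre_differential_equation a n
  have o2 := monicLaguerre_differential_equation a m
  have d2 := X_mul_derivative_monicLaguerre a m
  have r2 := X_mul_monicLaguerre a m
  rw [← hp] at o1
  rw [← hq] at o2 d2 r2
  have f1 : X * derivative (q * derivative p) + C (a + 1) * (q * derivative p) =
      X * (derivative q * derivative p) + X * (q * derivative p) - C (n : ℝ) * (q * p) := by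
    rw [derivative_mul]; linear_combination q * o1
  have f2 : X * derivative (p * derivative q) + C (a + 1) * (p * derivative q) =
      X * (derivative q * derivative p) + X * (p * derivative q) - C (m : ℝ) * (q * p) := by
    rw [derivative_mul]; linear_combination p * o2
  have f3 : X * derivative (q * p) + C (a + 1) * (q * p) =
      X * (q * derivative p) + X * (p * derivative q) + C (a + 1) * (q * p) := by
    rw [derivative_mul]; ring
  have f4 : X * (p * derivative q) =
      C (m : ℝ) * (q * p) + C (m * (m + a)) * (monicLaguerre a (m - 1) * p) := by
    linear_combination p * d2
  have f5 : X * (q * p) = monicLaguerre a (m + 1) * p + C (2 * m + a + 1) * (q * p)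
      + C (m * (m + a)) * (monicLaguerre a (m - 1) * p) := by
    linear_combination p * r2
  rw [f1, map_sub, map_add, smulC] at e1
  rw [f2, map_sub, map_add, smulC] at e2
  rw [f3, map_add, map_add, smulC] at e3
  have g4 := congrArg L f4
  have g5 := congrArg L f5
  rw [map_add, smulC, smulC] at g4
  rw [map_add, map_add, smulC, smulC] at g5
  push_cast at *
  linear_combination e2 - e1 + Complex.I * k * e3 - 2 * Complex.I * k * g4
    + (Complex.I * k * (1 - Complex.I * k)) * g5
    - k ^ 2 * ((2 * m + a + 1) * L (q * p) + L (monicLaguerre a (m + 1) * p)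
      + m * (m + a) * L (monicLaguerre a (m - 1) * p)) * Complex.I_sq
end Polynomials

/-! ### Integrals against the Laguerre weight -/

section Weight

variable {a : ℝ}

lemma laguerreWeight_eq_indicator (a : ℝ) : laguerreWeight a =
    (Set.Ioi 0).indicator (fun x => x ^ a * Real.exp (-x)) := by
  ext x; simp [laguerreWeight, Set.indicator_apply]

lemma laguerreWeight_nonneg (a x : ℝ) : 0 ≤ laguerreWeight a x := by
  unfold laguerreWeight; split_ifs <;> positivity

lemma measurable_laguerreWeight (a : ℝ) : Measurable (laguerreWeight a) := by
  rw [laguerreWeight_eq_indicator]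
  exact Measurable.indicator (by fun_prop) measurableSet_Ioi

lemma integrable_laguerreWeight_mul_exp_mul_pow (ha : -1 < a) {s : ℝ} (hs : s < 1) (j : ℕ) :
    Integrable (fun x => laguerreWeight a x * (Real.exp (s * x) * x ^ j)) := by
  have h := integrableOn_rpow_mul_exp_neg_mul_rpow (p := 1) (s := a + j) (b := 1 - s)
    (by have : (0 : ℝ) ≤ j := j.cast_nonneg
        linarith) zero_lt_one (by linarith)
  rw [← integrable_indicator_iff measurableSet_Ioi] at h
  refine h.congr (Eventually.of_forall fun x => ?_)
  simp only [laguerreWeight, Set.indicator_apply, Set.mem_Ioi]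
  split_ifs with hx
  · rw [Real.rpow_add hx, Real.rpow_natCast, Real.rpow_one,
      show -(1 - s) * x = -x + s * x by ring, Real.exp_add]
    ring
  · simp

open Polynomial in
lemma integrable_laguerreWeight_mul_exp_mul_eval (ha : -1 < a) {s : ℝ} (hs : s < 1) (p : ℝ[X]) :
    Integrable (fun x => laguerreWeight a x * (Real.exp (s * x) * p.eval x)) := by
  induction p using Polynomial.induction_on' with
  | add p q hp hq =>
    refine (hp.add hq).congr (Eventually.of_forall fun x => ?_)
    simp only [Pi.add_apply, eval_add]; ring
  | monomial n c =>
    refine ((integrable_laguerreWeight_mul_exp_mul_pow ha hs n).const_mul c).congr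
      (Eventually.of_forall fun x => ?_)
    simp only [eval_monomial]; ring

/-- The oscillating factor `e ^ (i k x)`. -/
noncomputable def wave (k x : ℝ) : ℂ := Complex.exp (Complex.I * (k : ℂ) * (x : ℂ))

lemma norm_wave (k x : ℝ) : ‖wave k x‖ = 1 := by
  rw [wave, show Complex.I * (k : ℂ) * (x : ℂ) = ((k * x : ℝ) : ℂ) * Complex.I by push_cast; ring]
  exact Complex.norm_exp_ofReal_mul_I _

lemma continuous_wave (k : ℝ) : Continuous (wave k) := by
  unfold wave; fun_prop

lemma conj_wave (k x : ℝ) : (starRingEnd ℂ) (wave k x) = wave (-k) x := by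
  rw [wave, wave, ← Complex.exp_conj]; simp

lemma wave_add (k r x : ℝ) : wave (k + r) x = wave k x * wave r x := by
  rw [wave, wave, wave, ← Complex.exp_add]; push_cast; ring_nf

lemma wave_mul_wave_neg (k x : ℝ) : wave k x * wave (-k) x = 1 := by
  rw [← wave_add]; simp [wave]

open Polynomial in
lemma integrable_laguerreWeight_mul_wave_mul_eval (ha : -1 < a) (k : ℝ) (p : ℝ[X]) :
    Integrable (fun x => (laguerreWeight a x : ℂ) * (wave k x * (p.eval x : ℝ))) := by
  have h := (integrable_laguerreWeight_mul_exp_mul_eval ha zero_lt_one p).ofReal (𝕜 := ℂ)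
  refine (h.bdd_mul (continuous_wave k).aestronglyMeasurable (c := 1)
    (Eventually.of_forall fun x => (norm_wave k x).le)).congr (Eventually.of_forall fun x => ?_)
  simp; ring

open Polynomial in
/-- The linear functional `p ↦ ∫ w x * e ^ (i k x) * p x` on polynomials. -/
noncomputable def waveFunctional (ha : -1 < a) (k : ℝ) : ℝ[X] →ₗ[ℝ] ℂ where
  toFun p := ∫ x, (laguerreWeight a x : ℂ) * (wave k x * (p.eval x : ℝ))
  map_add' p q := by
    rw [← integral_add (integrable_laguerreWeight_mul_wave_mul_eval ha k p)
      (integrable_laguerreWeight_mul_wave_mul_eval ha k q)]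
    congr 1 with x
    simp; ring
  map_smul' c p := by
    rw [RingHom.id_apply, ← integral_smul]
    congr 1 with x
    simp; ring

open Polynomial in
lemma waveFunctional_apply (ha : -1 < a) (k : ℝ) (p : ℝ[X]) : waveFunctional ha k p =
    ∫ x, (laguerreWeight a x : ℂ) * (wave k x * (p.eval x : ℝ)) := rfl

open Polynomial in
lemma isGammaFunctional_waveFunctional (ha : -1 < a) (k : ℝ) :
    IsGammaFunctional a (1 - Complex.I * k) (waveFunctional ha k) := by
  intro f
  induction f using Polynomial.induction_on' with
  | add p q hp hq =>
    rw [mul_add X, map_add _ (X * p), mul_add _ (waveFunctional ha k _), ← hp, ← hq, ← map_add]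
    congr 1
    simp only [derivative_add]; ring
  | monomial n c =>
    set z : ℂ := 1 - Complex.I * k with hz
    set g : ℝ[X] := X * derivative (monomial n c) + C (a + 1) * monomial n c with hg
    have hgx (x : ℝ) : g.eval x = (n + (a + 1)) * (c * x ^ n) := by
      rw [hg, derivative_monomial]
      cases n with
      | zero => simp
      | succ n => simp [pow_succ]; ring
    have hn : (0 : ℝ) ≤ n := n.cast_nonneg
    -- a primitive of the difference of the two integrands, with vanishing boundary values
    let F : ℝ → ℂ := fun x => ((c * x ^ (a + 1 + n) : ℝ) : ℂ) * Complex.exp (-z * x)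
    have hint := (integrable_laguerreWeight_mul_wave_mul_eval ha k g).sub
      ((integrable_laguerreWeight_mul_wave_mul_eval ha k (X * monomial n c)).const_mul z)
    set G : ℝ → ℂ := fun x => (laguerreWeight a x : ℂ) * (wave k x * (g.eval x : ℝ))
      - z * ((laguerreWeight a x : ℂ) * (wave k x * ((X * monomial n c).eval x : ℝ))) with hG
    have hexp (x : ℝ) : (Real.exp (-x) : ℂ) * wave k x = Complex.exp (-z * x) := by
      rw [wave, Complex.ofReal_exp, ← Complex.exp_add, hz]; push_cast; ring_nf
    have hderiv : ∀ x ∈ Set.Ioi (0 : ℝ), HasDerivAt F (G x) x := by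
      intro x hx
      have hx' : 0 < x := hx
      have h1 : HasDerivAt (fun x : ℝ => ((c * x ^ (a + 1 + n) : ℝ) : ℂ))
          ((c * ((a + 1 + n) * x ^ (a + 1 + n - 1)) : ℝ) : ℂ) x :=
        (((Real.hasDerivAt_rpow_const (Or.inl hx'.ne')).const_mul c)).ofReal_comp
      have h2 : HasDerivAt (fun x : ℝ => Complex.exp (-z * x)) (Complex.exp (-z * x) * (-z * 1)) x :=
        ((Complex.ofRealCLM.hasDerivAt.const_mul (-z))).cexp
      refine (h1.mul h2).congr_deriv ?_
      have e1 : x ^ (a + 1 + n - 1) = x ^ a * x ^ n := by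
        rw [← Real.rpow_natCast, ← Real.rpow_add hx']; ring_nf
      have e2 : x ^ (a + 1 + n) = x ^ a * x ^ n * x := by
        rw [← e1, ← Real.rpow_add_one hx'.ne']; ring_nf
      simp only [hG, laguerreWeight, if_pos hx', hgx, e1, e2, eval_mul, eval_X, eval_monomial,
        ← hexp]
      push_cast
      ring
    have h0 : ContinuousWithinAt F (Set.Ici 0) 0 := by
      refine ContinuousAt.continuousWithinAt ?_
      have : ContinuousAt (fun x : ℝ => x ^ (a + 1 + n)) 0 :=
        Real.continuousAt_rpow_const _ _ (Or.inr (by linarith))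
      refine ContinuousAt.mul (Complex.continuous_ofReal.continuousAt.comp
        (continuousAt_const.mul this)) ?_
      fun_prop
    have hlim : Tendsto F atTop (𝓝 0) := by
      rw [tendsto_zero_iff_norm_tendsto_zero]
      have h := (tendsto_rpow_mul_exp_neg_mul_atTop_nhds_zero (a + 1 + n) 1
        zero_lt_one).const_mul |c|
      rw [mul_zero] at h
      refine h.congr' ?_
      filter_upwards [eventually_gt_atTop 0] with x hx
      rw [norm_mul, Complex.norm_real, ← hexp, norm_mul (Real.exp (-x) : ℂ), norm_wave,
        Complex.norm_real, Real.norm_eq_abs, Real.norm_eq_abs, abs_mul, abs_of_pos (Real.exp_pos _),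
        abs_of_nonneg (Real.rpow_nonneg hx.le _)]
      ring_nf
    have key := integral_Ioi_of_hasDerivAt_of_tendsto h0 hderiv hint.integrableOn hlim
    have hF0 : F 0 = 0 := by
      simp [F, Real.zero_rpow (show a + 1 + n ≠ 0 by linarith)]
    -- the weight vanishes on the negative half-line
    have hwhole : ∫ x in Set.Ioi 0, G x = ∫ x, G x := by
      refine setIntegral_eq_integral_of_forall_compl_eq_zero fun x hx => ?_
      have : ¬ 0 < x := hx
      simp [hG, laguerreWeight, this]
    rw [hwhole, hF0, sub_zero, hG, integral_sub
      (integrable_laguerreWeight_mul_wave_mul_eval ha k g)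
      ((integrable_laguerreWeight_mul_wave_mul_eval ha k (X * monomial n c)).const_mul z),
      integral_const_mul] at key
    exact sub_eq_zero.mp key

end Weight

/-! ### Matrix elements of the oscillating factor -/

section MatrixElements

variable {a : ℝ}

/-- The squared norm `n! * Γ (n + a + 1)` of the `n`-th monic Laguerre polynomial. -/
noncomputable def laguerreNormSq (a : ℝ) : ℕ → ℝ
  | 0 => Real.Gamma (a + 1)
  | n + 1 => (n + 1) * (n + 1 + a) * laguerreNormSq a n

lemma laguerreNormSq_pos (ha : -1 < a) (n : ℕ) : 0 < laguerreNormSq a n := by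
  induction n with
  | zero => exact Real.Gamma_pos_of_pos (by linarith)
  | succ n ih =>
    have hn : (0 : ℝ) ≤ n := n.cast_nonneg
    rw [laguerreNormSq]
    have : 0 < n + 1 + a := by linarith
    positivity

/-- The integral of `w x * e ^ (i k x) * p_m x * p_n x`, where `p_m` and `p_n` are monic Laguerre
polynomials. -/
noncomputable def waveElement (ha : -1 < a) (k : ℝ) (m n : ℕ) : ℂ :=
  waveFunctional ha k (monicLaguerre a m * monicLaguerre a n)

lemma waveElement_comm (ha : -1 < a) (k : ℝ) (m n : ℕ) :
    waveElement ha k m n = waveElement ha k n m := by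
  rw [waveElement, mul_comm, waveElement]

lemma conj_waveElement (ha : -1 < a) (k : ℝ) (m n : ℕ) :
    (starRingEnd ℂ) (waveElement ha k m n) = waveElement ha (-k) m n := by
  rw [waveElement, waveElement, waveFunctional_apply, waveFunctional_apply, ← integral_conj]
  congr 1 with x
  simp [conj_wave]

lemma natCast_mul_waveElement (ha : -1 < a) (k : ℝ) (m n : ℕ) :
    (n : ℂ) * waveElement ha k m n = (m + k ^ 2 * (2 * m + a + 1)) * waveElement ha k m n
      + (k ^ 2 + Complex.I * k) * waveElement ha k (m + 1) n
      + (k ^ 2 - Complex.I * k) * (m * (m + a)) * waveElement ha k (m - 1) n :=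
  (isGammaFunctional_waveFunctional ha k).natCast_mul_apply m n

lemma waveElement_zero_of_ne (ha : -1 < a) {m n : ℕ} (h : m ≠ n) : waveElement ha 0 m n = 0 := by
  have e := natCast_mul_waveElement ha 0 m n
  have : ((n : ℂ) - m) * waveElement ha 0 m n = 0 := by
    push_cast at e
    linear_combination e
  refine (mul_eq_zero.mp this).resolve_left (sub_ne_zero.mpr ?_)
  exact_mod_cast h.symm

lemma waveElement_zero_self (ha : -1 < a) (n : ℕ) :
    waveElement ha 0 n n = laguerreNormSq a n := by
  induction n with
  | zero =>
    have h : ∫ x, (laguerreWeight a x : ℂ) = Real.Gamma (a + 1) := by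
      rw [integral_complex_ofReal, laguerreWeight_eq_indicator, integral_indicator measurableSet_Ioi,
        Real.Gamma_eq_integral (by linarith)]
      congr 1
      refine setIntegral_congr_fun measurableSet_Ioi fun x _ => ?_
      simp only [add_sub_cancel_right]; ring
    simpa [waveElement, waveFunctional_apply, monicLaguerre, laguerreNormSq, wave] using h
  | succ n ih =>
    set L := waveFunctional ha 0
    have smulC (c : ℝ) (p : Polynomial ℝ) : L (Polynomial.C c * p) = (c : ℂ) * L p := by
      rw [← Polynomial.smul_eq_C_mul, map_smul, Complex.real_smul]
    -- `⟨p_{n+1}, p_{n+1}⟩ = ⟨x p_n, p_{n+1}⟩ = ⟨p_n, x p_{n+1}⟩`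
    have e1 := congrArg (fun p => L (p * monicLaguerre a (n + 1))) (X_mul_monicLaguerre a n)
    have e2 := congrArg (fun p => L (p * monicLaguerre a n)) (X_mul_monicLaguerre a (n + 1))
    simp only [add_mul, map_add, mul_assoc (Polynomial.C _), smulC, Nat.add_sub_cancel] at e1 e2
    have e3 : L (Polynomial.X * monicLaguerre a n * monicLaguerre a (n + 1)) =
        L (Polynomial.X * monicLaguerre a (n + 1) * monicLaguerre a n) := by
      congr 1; ring
    have z1 : L (monicLaguerre a n * monicLaguerre a (n + 1)) = 0 :=
      waveElement_zero_of_ne ha (by omega)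
    have z2 : L (monicLaguerre a (n - 1) * monicLaguerre a (n + 1)) = 0 :=
      waveElement_zero_of_ne ha (by omega)
    have z3 : L (monicLaguerre a (n + 1 + 1) * monicLaguerre a n) = 0 :=
      waveElement_zero_of_ne ha (by omega)
    have z4 : L (monicLaguerre a (n + 1) * monicLaguerre a n) = 0 :=
      waveElement_zero_of_ne ha (by omega)
    have ih' : L (monicLaguerre a n * monicLaguerre a n) = laguerreNormSq a n := ih
    rw [e1, e2, z1, z2, z3, z4, ih'] at e3
    rw [waveElement, laguerreNormSq]
    push_cast at e3 ⊢
    linear_combination e3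

end MatrixElements

/-! ### Linear statistics of determinantal densities -/

section Determinantal

variable {ι : Type*} [Fintype ι] [DecidableEq ι]

lemma perm_filter_fix_compl_pair {i j : ι} (hij : i ≠ j) :
    (Finset.univ.filter fun ρ : Equiv.Perm ι => ∀ l ∉ ({i, j} : Finset ι), ρ l = l) =
      {1, Equiv.swap i j} := by
  ext ρ
  simp only [Finset.mem_filter, Finset.mem_univ, true_and, Finset.mem_insert,
    Finset.mem_singleton, not_or]
  constructor
  · intro h
    have hmem : ∀ m, (m = i ∨ m = j) → (ρ m = i ∨ ρ m = j) := by
      intro m hm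
      by_contra! hc
      have : ρ m = m := ρ.injective (h _ hc)
      rw [this] at hc
      tauto
    rcases hmem i (Or.inl rfl) with hi | hi
    · have hj : ρ j = j := (hmem j (Or.inr rfl)).resolve_left
        fun e => hij (ρ.injective (hi.trans e.symm))
      left
      ext l
      by_cases h1 : l = i
      · simp [h1, hi]
      · by_cases h2 : l = j
        · simp [h2, hj]
        · simpa using h l ⟨h1, h2⟩
    · have hj : ρ j = i := (hmem j (Or.inr rfl)).resolve_right
        fun e => hij (ρ.injective (hi.trans e.symm))
      right
      ext l
      by_cases h1 : l = i
      · simp [h1, hi]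
      · by_cases h2 : l = j
        · simp [h2, hj]
        · rw [Equiv.swap_apply_of_ne_of_ne h1 h2]; exact h l ⟨h1, h2⟩
  · rintro (rfl | rfl) l ⟨h1, h2⟩
    · simp
    · exact Equiv.swap_apply_of_ne_of_ne h1 h2

lemma perm_filter_fix_compl_singleton (i : ι) :
    (Finset.univ.filter fun ρ : Equiv.Perm ι => ∀ l ∉ ({i} : Finset ι), ρ l = l) = {1} := by
  ext ρ
  simp only [Finset.mem_filter, Finset.mem_univ, true_and, Finset.mem_singleton]
  constructor
  · intro h
    have hi : ρ i = i := by
      by_contra hc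
      exact hc (ρ.injective (h _ hc))
    ext l
    by_cases h1 : l = i
    · simp [h1, hi]
    · simpa using h l h1
  · rintro rfl; simp

/-- In the double Leibniz sum `ρ = σ⁻¹ * τ` may be used instead of `τ`; then the factors equal to the
identity matrix force `ρ` to fix the corresponding places. -/
lemma sum_perm_sum_perm_eq (A : ι → Matrix ι ι ℂ) (s : Finset ι) (hA : ∀ l ∉ s, A l = 1) :
    ∑ σ : Equiv.Perm ι, ∑ τ : Equiv.Perm ι,
      ((Equiv.Perm.sign σ : ℤ) : ℂ) * ((Equiv.Perm.sign τ : ℤ) : ℂ) * ∏ l, A l (σ l) (τ l) =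
    ∑ σ : Equiv.Perm ι,
      ∑ ρ ∈ Finset.univ.filter (fun ρ : Equiv.Perm ι => ∀ l ∉ s, ρ l = l),
        ((Equiv.Perm.sign ρ : ℤ) : ℂ) * ∏ l ∈ s, A l (σ l) (σ (ρ l)) := by
  refine Finset.sum_congr rfl fun σ _ => ?_
  rw [← Equiv.sum_comp (Equiv.mulLeft σ), Finset.sum_filter]
  refine Finset.sum_congr rfl fun ρ _ => ?_
  have hs : ((Equiv.Perm.sign σ : ℤ) : ℂ) * ((Equiv.Perm.sign (σ * ρ) : ℤ) : ℂ) =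
      ((Equiv.Perm.sign ρ : ℤ) : ℂ) := by
    rw [Equiv.Perm.sign_mul]
    push_cast
    rw [← mul_assoc]
    have : ((Equiv.Perm.sign σ : ℤ) : ℂ) * ((Equiv.Perm.sign σ : ℤ) : ℂ) = 1 := by
      rcases Int.units_eq_one_or (Equiv.Perm.sign σ) with h | h <;> simp [h]
    rw [this, one_mul]
  simp only [Equiv.coe_mulLeft, Equiv.Perm.coe_mul, Function.comp_apply]
  rw [hs]
  split_ifs with h
  · congr 1
    refine (Finset.prod_subset (Finset.subset_univ s) fun l _ hl => ?_).symm
    rw [h l hl, hA l hl, Matrix.one_apply_eq]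
  · push Not at h
    obtain ⟨l, hl, hne⟩ := h
    rw [Finset.prod_eq_zero (Finset.mem_univ l), mul_zero]
    rw [hA l hl, Matrix.one_apply_ne]
    exact fun e => hne (σ.injective e.symm)

/-- The determinantal density `∏ l, w (x l) * det (φ m (x l)) ^ 2`. -/
noncomputable def detDensity (w : ℝ → ℝ) (φ : ι → ℝ → ℝ) (x : ι → ℝ) : ℝ :=
  (∏ l, w (x l)) * (Matrix.of fun m l => φ m (x l)).det ^ 2

/-- The matrix of the multiplication operator by `F` in the system `φ`, for the weight `w`. -/
noncomputable def mulMatrix (w : ℝ → ℝ) (φ : ι → ℝ → ℝ) (F : ℝ → ℂ) : Matrix ι ι ℂ :=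
  Matrix.of fun m n => ∫ x, (w x : ℂ) * (F x * (φ m x * φ n x : ℝ))

/-- Integrability of all the entries of the matrix of the multiplication by `F`. -/
def MulIntegrable (w : ℝ → ℝ) (φ : ι → ℝ → ℝ) (F : ℝ → ℂ) : Prop :=
  ∀ m n, Integrable fun x => (w x : ℂ) * (F x * (φ m x * φ n x : ℝ))

variable {w : ℝ → ℝ} {φ : ι → ℝ → ℝ}

lemma detDensity_mul_prod (F : ι → ℝ → ℂ) (x : ι → ℝ) :
    (detDensity w φ x : ℂ) * ∏ l, F l (x l) =
      ∑ σ : Equiv.Perm ι, ∑ τ : Equiv.Perm ι,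
        ((Equiv.Perm.sign σ : ℤ) : ℂ) * ((Equiv.Perm.sign τ : ℤ) : ℂ) *
          ∏ l, (w (x l) : ℂ) * (F l (x l) * (φ (σ l) (x l) * φ (τ l) (x l) : ℝ)) := by
  rw [detDensity, sq, Matrix.det_apply']
  simp only [Matrix.of_apply]
  push_cast
  rw [Finset.sum_mul_sum, Finset.mul_sum, Finset.sum_mul]
  refine Finset.sum_congr rfl fun σ _ => ?_
  rw [Finset.mul_sum, Finset.sum_mul]
  refine Finset.sum_congr rfl fun τ _ => ?_
  simp only [Finset.prod_mul_distrib]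
  ring

lemma integrable_prod_entries {κ : Type*} [Fintype κ] {φ : κ → ℝ → ℝ} {F : κ → ℝ → ℂ}
    (hF : ∀ l, MulIntegrable w φ (F l)) (σ τ : Equiv.Perm κ) (c : ℂ) :
    Integrable fun x : κ → ℝ =>
      c * ∏ l, (w (x l) : ℂ) * (F l (x l) * (φ (σ l) (x l) * φ (τ l) (x l) : ℝ)) :=
  (Integrable.fintype_prod (μ := fun _ => volume) fun l => hF l (σ l) (τ l)).const_mul c

lemma integrable_detDensity_mul_prod {F : ι → ℝ → ℂ} (hF : ∀ l, MulIntegrable w φ (F l)) :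
    Integrable fun x => (detDensity w φ x : ℂ) * ∏ l, F l (x l) := by
  simp only [detDensity_mul_prod]
  exact integrable_finsetSum _ fun σ _ => integrable_finsetSum _ fun τ _ =>
    integrable_prod_entries hF σ τ _

/-- Andréief's formula, before the double sum is recognised as a determinant. -/
lemma integral_detDensity_mul_prod {F : ι → ℝ → ℂ} (hF : ∀ l, MulIntegrable w φ (F l)) :
    ∫ x, (detDensity w φ x : ℂ) * ∏ l, F l (x l) =
      ∑ σ : Equiv.Perm ι, ∑ τ : Equiv.Perm ι,
        ((Equiv.Perm.sign σ : ℤ) : ℂ) * ((Equiv.Perm.sign τ : ℤ) : ℂ) *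
          ∏ l, mulMatrix w φ (F l) (σ l) (τ l) := by
  simp only [detDensity_mul_prod]
  rw [integral_finsetSum _ fun σ _ => integrable_finsetSum _ fun τ _ =>
    integrable_prod_entries hF σ τ _]
  refine Finset.sum_congr rfl fun σ _ => ?_
  rw [integral_finsetSum _ fun τ _ => integrable_prod_entries hF σ τ _]
  refine Finset.sum_congr rfl fun τ _ => ?_
  rw [integral_const_mul]
  congr 1
  exact integral_fintype_prod_volume_eq_prod
    (fun l y => (w y : ℂ) * (F l y * (φ (σ l) y * φ (τ l) y : ℝ)))

lemma prod_ite_mul_ite (i j : ι) (f g : ℝ → ℂ) (x : ι → ℝ) :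
    ∏ l, ((if l = i then f (x l) else 1) * (if l = j then g (x l) else 1)) = f (x i) * g (x j) := by
  rw [Finset.prod_mul_distrib]
  simp

section Statistics

variable {f g : ℝ → ℂ}

lemma mulIntegrable_pair {κ : Type*} [DecidableEq κ] {φ : κ → ℝ → ℝ}
    (h1 : MulIntegrable w φ fun _ => 1) (hf : MulIntegrable w φ f) (hg : MulIntegrable w φ g)
    (hfg : MulIntegrable w φ fun x => f x * g x) (i j l : κ) :
    MulIntegrable w φ fun y => (if l = i then f y else 1) * (if l = j then g y else 1) := by
  split_ifs <;> simpa

lemma integrable_detDensity_mul_pair (h1 : MulIntegrable w φ fun _ => 1)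
    (hf : MulIntegrable w φ f) (hg : MulIntegrable w φ g)
    (hfg : MulIntegrable w φ fun x => f x * g x) (i j : ι) :
    Integrable fun x => (detDensity w φ x : ℂ) * (f (x i) * g (x j)) := by
  simpa only [prod_ite_mul_ite] using
    integrable_detDensity_mul_prod (mulIntegrable_pair h1 hf hg hfg i j)

lemma integral_detDensity_mul_pair (h1 : MulIntegrable w φ fun _ => 1)
    (hφ : mulMatrix w φ (fun _ => 1) = 1)
    (hf : MulIntegrable w φ f) (hg : MulIntegrable w φ g)
    (hfg : MulIntegrable w φ fun x => f x * g x) (i j : ι) :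
    ∫ x, (detDensity w φ x : ℂ) * (f (x i) * g (x j)) = ∑ σ : Equiv.Perm ι,
      ((if i = j then mulMatrix w φ (fun x => f x * g x) (σ i) (σ i) else 0)
        + (mulMatrix w φ f (σ i) (σ i) * mulMatrix w φ g (σ j) (σ j)
          - mulMatrix w φ f (σ i) (σ j) * mulMatrix w φ g (σ j) (σ i))) := by
  have key := integral_detDensity_mul_prod (mulIntegrable_pair h1 hf hg hfg i j)
  simp only [prod_ite_mul_ite] at key
  rw [key]
  by_cases hij : i = j
  · subst hij
    -- only `ρ = 1` fixes every place but `i`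
    rw [sum_perm_sum_perm_eq _ {i} (fun l hl => ?_), perm_filter_fix_compl_singleton]
    · simp
    · rw [Finset.mem_singleton] at hl
      simpa [hl] using hφ
  -- only `ρ = 1` and the transposition fix every place but `i` and `j`
  · rw [sum_perm_sum_perm_eq _ {i, j} (fun l hl => ?_), perm_filter_fix_compl_pair hij]
    · refine Finset.sum_congr rfl fun σ _ => ?_
      have hne : (1 : Equiv.Perm ι) ≠ Equiv.swap i j := fun e => by
        have := congrArg (fun ρ : Equiv.Perm ι => ρ i) e
        simp [hij] at this
      rw [Finset.sum_pair hne, Finset.prod_pair hij, Finset.prod_pair hij]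
      simp [hij, Ne.symm hij, Equiv.Perm.sign_swap hij, sub_eq_add_neg]
    · simp only [Finset.mem_insert, Finset.mem_singleton, not_or] at hl
      simpa [hl.1, hl.2] using hφ

/-- The two-point function of a determinantal density, integrated against `f` and `g`. -/
lemma integral_detDensity_mul_sum_mul_sum (h1 : MulIntegrable w φ fun _ => 1)
    (hφ : mulMatrix w φ (fun _ => 1) = 1)
    (hf : MulIntegrable w φ f) (hg : MulIntegrable w φ g)
    (hfg : MulIntegrable w φ fun x => f x * g x) :
    ∫ x, (detDensity w φ x : ℂ) * ((∑ i, f (x i)) * ∑ j, g (x j)) =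
      (Fintype.card ι).factorial * (∑ m, mulMatrix w φ (fun x => f x * g x) m m
        + ∑ m, ∑ n, (mulMatrix w φ f m m * mulMatrix w φ g n n
          - mulMatrix w φ f m n * mulMatrix w φ g n m)) := by
  simp only [Finset.sum_mul_sum, Finset.mul_sum _ _ (Complex.ofReal _)]
  rw [integral_finsetSum _ fun i _ => integrable_finsetSum _ fun j _ =>
    integrable_detDensity_mul_pair h1 hf hg hfg i j]
  have step (i : ι) : ∫ x, ∑ j, (detDensity w φ x : ℂ) * (f (x i) * g (x j)) =
      ∑ j, ∑ σ : Equiv.Perm ι,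
      ((if i = j then mulMatrix w φ (fun x => f x * g x) (σ i) (σ i) else 0)
        + (mulMatrix w φ f (σ i) (σ i) * mulMatrix w φ g (σ j) (σ j)
          - mulMatrix w φ f (σ i) (σ j) * mulMatrix w φ g (σ j) (σ i))) := by
    rw [integral_finsetSum _ fun j _ => integrable_detDensity_mul_pair h1 hf hg hfg i j]
    exact Finset.sum_congr rfl fun j _ => integral_detDensity_mul_pair h1 hφ hf hg hfg i j
  simp only [step]
  rw [Finset.sum_congr rfl fun i _ => Finset.sum_comm, Finset.sum_comm]
  rw [← Fintype.card_perm, ← nsmul_eq_mul, ← Finset.card_univ, ← Finset.sum_const]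
  refine Finset.sum_congr rfl fun σ _ => ?_
  simp only [Finset.sum_add_distrib, Finset.sum_ite_eq, Finset.mem_univ, if_true]
  congr 1
  · exact Equiv.sum_comp σ (fun m => mulMatrix w φ (fun x => f x * g x) m m)
  · let B : ι → ι → ℂ := fun m n => mulMatrix w φ f m m * mulMatrix w φ g n n
      - mulMatrix w φ f m n * mulMatrix w φ g n m
    exact (Finset.sum_congr rfl fun i _ => Equiv.sum_comp σ (B (σ i))).trans
      (Equiv.sum_comp σ fun m => ∑ n, B m n)

lemma integral_detDensity_mul_sum (h1 : MulIntegrable w φ fun _ => 1)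
    (hφ : mulMatrix w φ (fun _ => 1) = 1) (hf : MulIntegrable w φ f) :
    ∫ x, (detDensity w φ x : ℂ) * ∑ i, f (x i) =
      (Fintype.card ι).factorial * ∑ m, mulMatrix w φ f m m := by
  have hf1 : MulIntegrable w φ fun x => f x * (fun _ => (1 : ℂ)) x := by simpa using hf
  simp only [Finset.mul_sum]
  have hint (i : ι) : Integrable fun x => (detDensity w φ x : ℂ) * f (x i) := by
    simpa using integrable_detDensity_mul_pair h1 hf h1 hf1 i i
  rw [integral_finsetSum _ fun i _ => hint i]
  have step (i : ι) : ∫ x, (detDensity w φ x : ℂ) * f (x i) =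
      ∑ σ : Equiv.Perm ι, mulMatrix w φ f (σ i) (σ i) := by
    simpa using integral_detDensity_mul_pair h1 hφ hf h1 hf1 i i
  simp only [step]
  rw [Finset.sum_comm, ← Finset.mul_sum]
  rw [← Fintype.card_perm, ← nsmul_eq_mul, ← Finset.card_univ, ← Finset.sum_const]
  exact Finset.sum_congr rfl fun σ _ => Equiv.sum_comp σ (fun m => mulMatrix w φ f m m)

lemma integrable_detDensity (h1 : MulIntegrable w φ fun _ => 1) :
    Integrable (detDensity w φ) := by
  have := (integrable_detDensity_mul_prod (F := fun _ _ => 1) fun _ => h1).re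
  simpa using this

lemma integral_detDensity (h1 : MulIntegrable w φ fun _ => 1)
    (hφ : mulMatrix w φ (fun _ => 1) = 1) :
    ∫ x, detDensity w φ x = (Fintype.card ι).factorial := by
  have key := integral_detDensity_mul_prod (F := fun _ _ => 1) fun _ => h1
  rw [sum_perm_sum_perm_eq _ ∅ (fun l _ => hφ)] at key
  have hone : (Finset.univ.filter fun ρ : Equiv.Perm ι => ∀ l ∉ (∅ : Finset ι), ρ l = l) = {1} := by
    ext ρ; simp [Equiv.ext_iff]
  rw [hone] at key
  simp only [Finset.prod_const_one, mul_one, Finset.sum_singleton, Finset.prod_empty,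
    Equiv.Perm.sign_one, Units.val_one, Int.cast_one, Finset.sum_const, Finset.card_univ,
    Fintype.card_perm, nsmul_eq_mul, integral_complex_ofReal] at key
  exact_mod_cast key

end Statistics

end Determinantal

/-! ### The structure function as a defect from unitarity -/

section LaguerreEnsemble

variable {a : ℝ}

/-- The orthonormal polynomials for the Laguerre weight, without the square root of the weight. -/
noncomputable def normalizedLaguerre (a : ℝ) (n : ℕ) (x : ℝ) : ℝ :=
  (monicLaguerre a n).eval x / √(laguerreNormSq a n)

/-- The matrix of the multiplication by `e ^ (i k x)` in the orthonormal Laguerre system. -/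
noncomputable def waveMatrix (ha : -1 < a) (k : ℝ) (m n : ℕ) : ℂ :=
  waveElement ha k m n / (√(laguerreNormSq a m) * √(laguerreNormSq a n) : ℝ)

lemma mulMatrix_normalizedLaguerre (ha : -1 < a) (k : ℝ) (m n : ℕ) :
    ∫ x, (laguerreWeight a x : ℂ) *
      (wave k x * (normalizedLaguerre a m x * normalizedLaguerre a n x : ℝ)) =
      waveMatrix ha k m n := by
  rw [waveMatrix, waveElement, waveFunctional_apply, ← integral_div]
  congr 1 with x
  rw [normalizedLaguerre, normalizedLaguerre, div_mul_div_comm, Polynomial.eval_mul]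
  push_cast
  ring

lemma mulIntegrable_normalizedLaguerre (ha : -1 < a) (N : ℕ) (k : ℝ) :
    MulIntegrable (laguerreWeight a) (fun m : Fin N => normalizedLaguerre a m) (wave k) := by
  intro m n
  refine ((integrable_laguerreWeight_mul_wave_mul_eval ha k
    (monicLaguerre a m * monicLaguerre a n)).div_const
      ((√(laguerreNormSq a m) * √(laguerreNormSq a n) : ℝ) : ℂ)).congr
    (Eventually.of_forall fun x => ?_)
  simp only [normalizedLaguerre, div_mul_div_comm, Polynomial.eval_mul]
  push_cast
  ring

lemma conj_waveMatrix (ha : -1 < a) (k : ℝ) (m n : ℕ) :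
    (starRingEnd ℂ) (waveMatrix ha k m n) = waveMatrix ha (-k) m n := by
  rw [waveMatrix, map_div₀, conj_waveElement, Complex.conj_ofReal, waveMatrix]

lemma waveMatrix_comm (ha : -1 < a) (k : ℝ) (m n : ℕ) :
    waveMatrix ha k m n = waveMatrix ha k n m := by
  rw [waveMatrix, waveElement_comm, mul_comm, waveMatrix]

lemma waveMatrix_zero (ha : -1 < a) (m n : ℕ) :
    waveMatrix ha 0 m n = if m = n then 1 else 0 := by
  split_ifs with h
  · subst h
    rw [waveMatrix, waveElement_zero_self, Real.mul_self_sqrt (laguerreNormSq_pos ha m).le]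
    exact div_self (Complex.ofReal_ne_zero.mpr (laguerreNormSq_pos ha m).ne')
  · rw [waveMatrix, waveElement_zero_of_ne ha h, zero_div]

/-- The squared Vandermonde determinant is a squared determinant of orthonormal polynomials. -/
lemma unnormalizedDensity_eq (ha : -1 < a) (N : ℕ) (x : Fin N → ℝ) :
    unnormalizedDensity (laguerreWeight a) N x = (∏ m : Fin N, laguerreNormSq a m) *
      detDensity (laguerreWeight a) (fun m : Fin N => normalizedLaguerre a m) x := by
  have hv := Matrix.det_eval_matrixOfPolynomials_eq_det_vandermonde x
    (fun m : Fin N => monicLaguerre a m)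
    (fun m => (degree_monicLaguerre_and_monic a m).1)
    (fun m => (degree_monicLaguerre_and_monic a m).2)
  have hm : (Matrix.of fun i j : Fin N => (monicLaguerre a j).eval (x i)).det =
      (∏ m : Fin N, √(laguerreNormSq a m)) *
        (Matrix.of fun m l : Fin N => normalizedLaguerre a m (x l)).det := by
    rw [← Matrix.det_transpose, ← Matrix.det_mul_column]
    congr 1
    ext m l
    have := (Real.sqrt_pos.mpr (laguerreNormSq_pos ha m)).ne'
    simp only [Matrix.transpose_apply, Matrix.of_apply, normalizedLaguerre]
    field_simp
  have hs : (∏ m : Fin N, √(laguerreNormSq a m)) ^ 2 = ∏ m : Fin N, laguerreNormSq a m := by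
    rw [← Finset.prod_pow]
    exact Finset.prod_congr rfl fun m _ => Real.sq_sqrt (laguerreNormSq_pos ha m).le
  rw [unnormalizedDensity, detDensity, ← hs]
  simp only [sq_abs, Finset.prod_pow]
  rw [← Matrix.det_vandermonde, hv, hm]
  ring

lemma mulMatrix_one (ha : -1 < a) (N : ℕ) :
    mulMatrix (laguerreWeight a) (fun m : Fin N => normalizedLaguerre a m) (fun _ => 1) = 1 := by
  ext m n
  have h := mulMatrix_normalizedLaguerre ha 0 m n
  rw [waveMatrix_zero] at h
  simp only [show wave 0 = fun _ => 1 by ext; simp [wave]] at h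
  rw [mulMatrix, Matrix.of_apply, h, Matrix.one_apply]
  simp [Fin.ext_iff]

lemma mulIntegrable_one (ha : -1 < a) (N : ℕ) :
    MulIntegrable (laguerreWeight a) (fun m : Fin N => normalizedLaguerre a m) (fun _ => 1) := by
  simpa [show wave 0 = fun _ => 1 by ext; simp [wave]] using
    mulIntegrable_normalizedLaguerre ha N 0

lemma jointDensity_eq (ha : -1 < a) (N : ℕ) (x : Fin N → ℝ) :
    jointDensity (laguerreWeight a) N x = (N.factorial : ℝ)⁻¹ *
      detDensity (laguerreWeight a) (fun m : Fin N => normalizedLaguerre a m) x := by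
  have hp : (0 : ℝ) < ∏ m : Fin N, laguerreNormSq a m :=
    Finset.prod_pos fun m _ => laguerreNormSq_pos ha m
  have hC : normalizationConstant (laguerreWeight a) N =
      (∏ m : Fin N, laguerreNormSq a m) * N.factorial := by
    simp only [normalizationConstant, unnormalizedDensity_eq ha]
    rw [integral_const_mul, integral_detDensity (mulIntegrable_one ha N) (mulMatrix_one ha N),
      Fintype.card_fin]
  rw [jointDensity, hC, unnormalizedDensity_eq ha]
  have := hp.ne'
  field_simp

lemma jointDensity_laguerre_nonneg (ha : -1 < a) (N : ℕ) (x : Fin N → ℝ) :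
    0 ≤ jointDensity (laguerreWeight a) N x := by
  rw [jointDensity_eq ha, detDensity]
  have : 0 ≤ ∏ l, laguerreWeight a (x l) := Finset.prod_nonneg fun l _ => laguerreWeight_nonneg a _
  positivity

lemma integrable_jointDensity_laguerre (ha : -1 < a) (N : ℕ) :
    Integrable (jointDensity (laguerreWeight a) N) := by
  rw [show jointDensity (laguerreWeight a) N = fun x => _ from funext (jointDensity_eq ha N)]
  exact (integrable_detDensity (mulIntegrable_one ha N)).const_mul _

lemma integral_jointDensity_laguerre (ha : -1 < a) (N : ℕ) :
    ∫ x, jointDensity (laguerreWeight a) N x = 1 := by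
  simp only [jointDensity_eq ha]
  rw [integral_const_mul, integral_detDensity (mulIntegrable_one ha N) (mulMatrix_one ha N),
    Fintype.card_fin]
  exact inv_mul_cancel₀ (by positivity)

/-- The structure function measures how far the truncated matrix of `e ^ (i k x)` is from being
unitary. -/
lemma structureFunction_laguerre (ha : -1 < a) (N : ℕ) (k : ℝ) :
    structureFunction (laguerreWeight a) N k =
      N - ∑ m ∈ Finset.range N, ∑ n ∈ Finset.range N, ‖waveMatrix ha k m n‖ ^ 2 := by
  have hN : (N.factorial : ℂ) ≠ 0 := by exact_mod_cast N.factorial_ne_zero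
  have hone : (fun x => wave k x * wave (-k) x) = fun _ => 1 := funext (wave_mul_wave_neg k)
  set M := fun k => mulMatrix (laguerreWeight a) (fun m : Fin N => normalizedLaguerre a m) (wave k)
    with hMdef
  have hM (k : ℝ) (m n : Fin N) : M k m n = waveMatrix ha k m n := by
    rw [hMdef]; exact mulMatrix_normalizedLaguerre ha k m n
  have hw (x : Fin N → ℝ) : exponentialStatistic k x = ∑ j, wave k (x j) := rfl
  -- the mean of the statistic
  have hmean : ensembleAverage (laguerreWeight a) N (fun x => exponentialStatistic k x) =
      ∑ m, M k m m := by
    have h := integral_detDensity_mul_sum (mulIntegrable_one ha N) (mulMatrix_one ha N)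
      (mulIntegrable_normalizedLaguerre ha N k)
    simp only [ensembleAverage, jointDensity_eq ha, hw, Complex.real_smul, Complex.ofReal_mul,
      mul_assoc]
    rw [integral_const_mul, h, Fintype.card_fin, ← mul_assoc]
    push_cast
    rw [inv_mul_cancel₀ hN, one_mul]
  -- the mean of its squared modulus
  have hsq : ((ensembleAverage (laguerreWeight a) N (fun x => ‖exponentialStatistic k x‖ ^ 2) : ℝ) :
      ℂ) = N + ∑ m, ∑ n, (M k m m * M (-k) n n - M k m n * M (-k) n m) := by
    have h := integral_detDensity_mul_sum_mul_sum (mulIntegrable_one ha N) (mulMatrix_one ha N)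
      (mulIntegrable_normalizedLaguerre ha N k) (mulIntegrable_normalizedLaguerre ha N (-k))
      (by rw [hone]; exact mulIntegrable_one ha N)
    rw [hone, mulMatrix_one ha] at h
    have hconj (x : Fin N → ℝ) : ((‖exponentialStatistic k x‖ ^ 2 : ℝ) : ℂ) =
        (∑ j, wave k (x j)) * ∑ j, wave (-k) (x j) := by
      rw [hw, Complex.ofReal_pow, ← Complex.mul_conj', map_sum]
      simp only [conj_wave]
    rw [ensembleAverage, ← integral_complex_ofReal]
    simp only [smul_eq_mul, Complex.ofReal_mul, hconj, jointDensity_eq ha, mul_assoc]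
    rw [integral_const_mul, h, Fintype.card_fin, ← mul_assoc]
    push_cast
    rw [inv_mul_cancel₀ hN, one_mul]
    simp [hMdef]
  have hnorm : ((‖∑ m, M k m m‖ ^ 2 : ℝ) : ℂ) = ∑ m, ∑ n, M k m m * M (-k) n n := by
    rw [Complex.ofReal_pow, ← Complex.mul_conj', map_sum, Finset.sum_mul_sum]
    simp only [hM, conj_waveMatrix]
  have hentry (m n : Fin N) : M k m n * M (-k) n m = ((‖waveMatrix ha k m n‖ ^ 2 : ℝ) : ℂ) := by
    rw [hM, hM, waveMatrix_comm ha (-k), ← conj_waveMatrix, Complex.mul_conj', Complex.ofReal_pow]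
  rw [structureFunction, hmean]
  apply Complex.ofReal_injective
  rw [Complex.ofReal_sub, hsq, hnorm]
  simp only [hentry, Finset.sum_sub_distrib, Finset.sum_range]
  push_cast
  ring

end LaguerreEnsemble

/-! ### Unitarity of the infinite matrix -/

open scoped InnerProductSpace

section HilbertSpace

/-- Parseval's identity for two vectors in the closed span of an orthonormal sequence. -/
lemma hasSum_inner_mul_inner_of_mem_closure_span {H : Type*} [NormedAddCommGroup H]
    [InnerProductSpace ℂ H] [CompleteSpace H] {e : ℕ → H} (he : Orthonormal ℂ e) {u v : H}
    (hu : u ∈ (Submodule.span ℂ (Set.range e)).topologicalClosure)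
    (hv : v ∈ (Submodule.span ℂ (Set.range e)).topologicalClosure) :
    HasSum (fun n => ⟪u, e n⟫_ℂ * ⟪e n, v⟫_ℂ) ⟪u, v⟫_ℂ := by
  set K := (Submodule.span ℂ (Set.range e)).topologicalClosure with hK
  have hmem (n : ℕ) : e n ∈ K :=
    Submodule.le_topologicalClosure _ (Submodule.subset_span ⟨n, rfl⟩)
  let e' : ℕ → K := fun n => ⟨e n, hmem n⟩
  have he' : Orthonormal ℂ e' := by
    rw [orthonormal_iff_ite] at he ⊢
    exact he
  have hcomp : CompleteSpace K :=
    (Submodule.isClosed_topologicalClosure _).completeSpace_coe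
  have hbot : (Submodule.span ℂ (Set.range e'))ᗮ = ⊥ := by
    rw [Submodule.eq_bot_iff]
    intro w hw
    have h1 : (w : H) ∈ (Submodule.span ℂ (Set.range e))ᗮ := by
      rw [Submodule.mem_orthogonal]
      intro y hy
      induction hy using Submodule.span_induction with
      | mem y hy =>
        obtain ⟨n, rfl⟩ := hy
        exact (Submodule.mem_orthogonal _ _).mp hw (e' n) (Submodule.subset_span ⟨n, rfl⟩)
      | zero => simp
      | add y z _ _ h1 h2 => rw [inner_add_left, h1, h2, add_zero]
      | smul c y _ h1 => rw [inner_smul_left, h1, mul_zero]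
    rw [← Submodule.orthogonal_closure] at h1
    have h2 : ⟪(w : H), (w : H)⟫_ℂ = 0 := Submodule.inner_right_of_mem_orthogonal w.2 h1
    exact Subtype.ext (inner_self_eq_zero.mp h2)
  let b := HilbertBasis.mkOfOrthogonalEqBot he' hbot
  have hb := b.hasSum_inner_mul_inner ⟨u, hu⟩ ⟨v, hv⟩
  simpa [b, e'] using hb

end HilbertSpace

section Completeness

open Polynomial

variable {a : ℝ}

/-- The measure with the Laguerre weight as its density. -/
noncomputable def laguerreMeasure (a : ℝ) : Measure ℝ :=
  volume.withDensity fun x => ENNReal.ofReal (laguerreWeight a x)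

lemma integrable_laguerreMeasure_iff {E : Type*} [NormedAddCommGroup E] [NormedSpace ℝ E]
    {f : ℝ → E} :
    Integrable f (laguerreMeasure a) ↔ Integrable fun x => laguerreWeight a x • f x := by
  rw [laguerreMeasure, integrable_withDensity_iff_integrable_smul'
    (measurable_laguerreWeight a).ennreal_ofReal (by simp)]
  simp only [ENNReal.toReal_ofReal (laguerreWeight_nonneg a _)]

lemma integral_laguerreMeasure (f : ℝ → ℂ) :
    ∫ x, f x ∂laguerreMeasure a = ∫ x, (laguerreWeight a x : ℂ) * f x := by
  rw [laguerreMeasure, integral_withDensity_eq_integral_toReal_smul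
    (measurable_laguerreWeight a).ennreal_ofReal (by simp)]
  simp only [ENNReal.toReal_ofReal (laguerreWeight_nonneg a _), Complex.real_smul]

/-- The weight is supported on the half-line, so growth of order `e ^ (s |x|)` with `s < 1` is
harmless. -/
lemma memLp_exp_abs_mul_eval (ha : -1 < a) {s : ℝ} (hs : s < 1 / 2) (p : ℝ[X]) :
    MemLp (fun x => Real.exp (s * |x|) * p.eval x) 2 (laguerreMeasure a) := by
  rw [memLp_two_iff_integrable_sq (by fun_prop), integrable_laguerreMeasure_iff]
  refine (integrable_laguerreWeight_mul_exp_mul_eval ha (show 2 * s < 1 by linarith)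
    (p * p)).congr (Eventually.of_forall fun x => ?_)
  simp only [laguerreWeight, smul_eq_mul]
  split_ifs with hx
  · rw [abs_of_pos hx, mul_pow, sq (Real.exp _), ← Real.exp_add, eval_mul]
    ring_nf
  · simp

lemma memLp_wave_mul_eval (ha : -1 < a) (k : ℝ) (p : ℝ[X]) :
    MemLp (fun x => wave k x * (p.eval x : ℝ)) 2 (laguerreMeasure a) := by
  refine (memLp_exp_abs_mul_eval ha (s := 0) (by norm_num) p).of_le ?_
    (Eventually.of_forall fun x => ?_)
  · have := continuous_wave k
    have : Continuous fun x => wave k x * (p.eval x : ℝ) := by fun_prop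
    exact this.aestronglyMeasurable
  · simp [norm_wave]

/-- The function `e ^ (i k x) * p x` as a vector of the Hilbert space of the Laguerre weight. -/
noncomputable def waveVector (ha : -1 < a) (k : ℝ) (p : ℝ[X]) : Lp ℂ 2 (laguerreMeasure a) :=
  (memLp_wave_mul_eval ha k p).toLp

lemma inner_waveVector (ha : -1 < a) (k : ℝ) (p : ℝ[X]) (f : Lp ℂ 2 (laguerreMeasure a)) :
    ⟪f, waveVector ha k p⟫_ℂ =
      ∫ x, (starRingEnd ℂ) (f x) * (wave k x * (p.eval x : ℝ)) ∂laguerreMeasure a := by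
  rw [L2.inner_def]
  refine integral_congr_ae ?_
  filter_upwards [(memLp_wave_mul_eval ha k p).coeFn_toLp] with x hx
  rw [waveVector, hx, RCLike.inner_apply, mul_comm]

lemma inner_waveVector_waveVector (ha : -1 < a) (k l : ℝ) (p q : ℝ[X]) :
    ⟪waveVector ha l q, waveVector ha k p⟫_ℂ = waveFunctional ha (k - l) (q * p) := by
  rw [inner_waveVector, waveFunctional_apply, ← integral_laguerreMeasure]
  refine integral_congr_ae ?_
  filter_upwards [(memLp_wave_mul_eval ha l q).coeFn_toLp] with x hx
  rw [waveVector, hx, map_mul, conj_wave, Complex.conj_ofReal, sub_eq_add_neg, wave_add, eval_mul]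
  push_cast
  ring

lemma integrable_conj_mul_wave_mul_eval (ha : -1 < a) (k : ℝ) (p : ℝ[X])
    (f : Lp ℂ 2 (laguerreMeasure a)) :
    Integrable (fun x => (starRingEnd ℂ) (f x) * (wave k x * (p.eval x : ℝ)))
      (laguerreMeasure a) := by
  have := (Lp.memLp f).star.integrable_mul (memLp_wave_mul_eval ha k p)
  exact this

/-- `p ↦ ⟪f, e ^ (i k x) p⟫` as a linear map. -/
noncomputable def innerWave (ha : -1 < a) (k : ℝ) (f : Lp ℂ 2 (laguerreMeasure a)) :
    ℝ[X] →ₗ[ℝ] ℂ where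
  toFun p := ∫ x, (starRingEnd ℂ) (f x) * (wave k x * (p.eval x : ℝ)) ∂laguerreMeasure a
  map_add' p q := by
    rw [← integral_add (integrable_conj_mul_wave_mul_eval ha k p f)
      (integrable_conj_mul_wave_mul_eval ha k q f)]
    congr 1 with x
    simp; ring
  map_smul' c p := by
    rw [RingHom.id_apply, ← integral_smul]
    congr 1 with x
    simp; ring

lemma inner_waveVector_eq_innerWave (ha : -1 < a) (k : ℝ) (p : ℝ[X])
    (f : Lp ℂ 2 (laguerreMeasure a)) : ⟪f, waveVector ha k p⟫_ℂ = innerWave ha k f p :=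
  inner_waveVector ha k p f

lemma innerWave_X_pow_mul_eq_zero (ha : -1 < a) {k : ℝ} {f : Lp ℂ 2 (laguerreMeasure a)}
    (h : ∀ n, innerWave ha k f (monicLaguerre a n) = 0) (j n : ℕ) :
    innerWave ha k f (X ^ j * monicLaguerre a n) = 0 := by
  induction j generalizing n with
  | zero => simpa using h n
  | succ j ih =>
    have e : X ^ (j + 1) * monicLaguerre a n = X ^ j * monicLaguerre a (n + 1)
        + (2 * n + a + 1 : ℝ) • (X ^ j * monicLaguerre a n)
        + (n * (n + a) : ℝ) • (X ^ j * monicLaguerre a (n - 1)) := by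
      rw [smul_eq_C_mul, smul_eq_C_mul]
      linear_combination X ^ j * X_mul_monicLaguerre a n
    rw [e, map_add, map_add, map_smul, map_smul, ih, ih, ih]
    simp

/-- A vector orthogonal to all `e ^ (i k x) p` with polynomials `p` is orthogonal to all
`e ^ (i (k + r) x) p`, if `r` is small enough for the Taylor series of `e ^ (i r x)` to converge
dominatedly. -/
lemma innerWave_add_eq_zero (ha : -1 < a) {k r : ℝ} (hr : |r| < 1 / 2)
    {f : Lp ℂ 2 (laguerreMeasure a)} (h : ∀ n, innerWave ha k f (monicLaguerre a n) = 0) (n : ℕ) :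
    innerWave ha (k + r) f (monicLaguerre a n) = 0 := by
  set p := monicLaguerre a n with hp
  -- the Taylor polynomials of `e ^ (i r x)`, and the integrands they give
  let S : ℕ → ℝ → ℂ := fun J x =>
    ∑ j ∈ Finset.range J, (Complex.I * r * x) ^ j / (j.factorial : ℂ)
  let F : ℕ → ℝ → ℂ := fun J x =>
    (starRingEnd ℂ) (f x) * (S J x * (wave k x * (p.eval x : ℝ)))
  have hterm (J : ℕ) (x : ℝ) : F J x = ∑ j ∈ Finset.range J, (Complex.I * r) ^ j / j.factorial *
      ((starRingEnd ℂ) (f x) * (wave k x * ((X ^ j * p).eval x : ℝ))) := by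
    simp only [F, S]
    rw [Finset.sum_mul, Finset.mul_sum]
    refine Finset.sum_congr rfl fun j _ => ?_
    rw [eval_mul, eval_pow, eval_X, mul_pow]
    push_cast
    ring
  have hintF (J : ℕ) : Integrable (F J) (laguerreMeasure a) := by
    simp only [show F J = fun x => F J x from rfl, hterm]
    exact integrable_finsetSum _ fun j _ =>
      (integrable_conj_mul_wave_mul_eval ha k (X ^ j * p) f).const_mul _
  have hzero (J : ℕ) : ∫ x, F J x ∂laguerreMeasure a = 0 := by
    simp only [hterm]
    rw [integral_finsetSum _ fun j _ =>
      (integrable_conj_mul_wave_mul_eval ha k (X ^ j * p) f).const_mul _]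
    refine Finset.sum_eq_zero fun j _ => ?_
    rw [integral_const_mul]
    exact mul_eq_zero_of_right _ (innerWave_X_pow_mul_eq_zero ha h j n)
  have hbound : Integrable (fun x => ‖f x‖ * ‖Real.exp (|r| * |x|) * p.eval x‖)
      (laguerreMeasure a) :=
    (Lp.memLp f).norm.integrable_mul (memLp_exp_abs_mul_eval ha hr p).norm
  have hlim := tendsto_integral_of_dominated_convergence (F := F)
    (f := fun x => (starRingEnd ℂ) (f x) * (wave (k + r) x * (p.eval x : ℝ)))
    (fun x => ‖f x‖ * ‖Real.exp (|r| * |x|) * p.eval x‖)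
    (fun J => (hintF J).aestronglyMeasurable) hbound
    (fun J => Eventually.of_forall fun x => ?_) (Eventually.of_forall fun x => ?_)
  · simp only [hzero] at hlim
    exact (tendsto_nhds_unique tendsto_const_nhds hlim).symm
  · have hS : ‖S J x‖ ≤ Real.exp (|r| * |x|) := by
      refine (norm_sum_le _ _).trans
        (le_trans (le_of_eq ?_) (Real.sum_le_exp_of_nonneg (x := |r| * |x|) (by positivity) J))
      refine Finset.sum_congr rfl fun j _ => ?_
      simp
    simp only [F]
    rw [norm_mul, RCLike.norm_conj, norm_mul, norm_mul, norm_wave, one_mul, norm_mul,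
      Real.norm_of_nonneg (Real.exp_pos _).le, Complex.norm_real]
    gcongr
  · have hS : Tendsto (fun J => S J x) atTop (𝓝 (wave r x)) := by
      have := (NormedSpace.expSeries_div_hasSum_exp (Complex.I * r * x)).tendsto_sum_nat
      rwa [← Complex.exp_eq_exp_ℂ] at this
    have e : wave (k + r) x * (p.eval x : ℝ) = wave r x * (wave k x * (p.eval x : ℝ)) := by
      rw [wave_add]; ring
    rw [e]
    exact (hS.mul_const _).const_mul _

lemma innerWave_eq_zero (ha : -1 < a) {f : Lp ℂ 2 (laguerreMeasure a)}
    (h : ∀ n, innerWave ha 0 f (monicLaguerre a n) = 0) (k : ℝ) (n : ℕ) :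
    innerWave ha k f (monicLaguerre a n) = 0 := by
  -- reach `k` in `M` steps, each short enough for the Taylor argument
  obtain ⟨M, hM⟩ := exists_nat_gt (2 * |k|)
  have hM0 : (0 : ℝ) < M := lt_of_le_of_lt (by positivity) hM
  have hr : |k / M| < 1 / 2 := by
    rw [abs_div, abs_of_pos hM0, div_lt_iff₀ hM0]; linarith
  have step (j : ℕ) : ∀ n, innerWave ha (j * (k / M)) f (monicLaguerre a n) = 0 := by
    induction j with
    | zero => simpa using h
    | succ j ih =>
      intro n
      have := innerWave_add_eq_zero ha hr ih n
      rwa [show ((j + 1 : ℕ) : ℝ) * (k / M) = j * (k / M) + k / M by push_cast; ring]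
  have := step M n
  rwa [mul_div_cancel₀ _ hM0.ne'] at this

/-- The rows of the matrix of `e ^ (i k x)` are orthonormal: multiplication by this factor is
unitary, and preserves the closure of the polynomials. -/
lemma hasSum_waveElement_mul_conj (ha : -1 < a) (k : ℝ) (m l : ℕ) :
    HasSum (fun n => waveElement ha k m n * (starRingEnd ℂ) (waveElement ha k l n)
      / laguerreNormSq a n) (waveElement ha 0 m l) := by
  let e : ℕ → Lp ℂ 2 (laguerreMeasure a) := fun n =>
    ((√(laguerreNormSq a n))⁻¹ : ℂ) • waveVector ha 0 (monicLaguerre a n)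
  have hpos (n : ℕ) : 0 < √(laguerreNormSq a n) := Real.sqrt_pos.mpr (laguerreNormSq_pos ha n)
  have he : Orthonormal ℂ e := by
    rw [orthonormal_iff_ite]
    intro i j
    have hij : ⟪e i, e j⟫_ℂ = waveMatrix ha 0 i j := by
      simp only [e]
      rw [inner_smul_left, inner_smul_right, inner_waveVector_waveVector, sub_zero, waveMatrix,
        waveElement, ← Complex.ofReal_inv, Complex.conj_ofReal]
      push_cast
      rw [div_eq_mul_inv, mul_inv]
      ring
    rw [hij, waveMatrix_zero]
  have hmem (m : ℕ) : waveVector ha k (monicLaguerre a m) ∈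
      (Submodule.span ℂ (Set.range e)).topologicalClosure := by
    have : CompleteSpace (Submodule.span ℂ (Set.range e)).topologicalClosure :=
      (Submodule.isClosed_topologicalClosure _).completeSpace_coe
    rw [← Submodule.orthogonal_orthogonal (Submodule.span ℂ (Set.range e)).topologicalClosure,
      Submodule.mem_orthogonal]
    intro f hf
    rw [inner_waveVector_eq_innerWave]
    refine innerWave_eq_zero ha (fun n => ?_) k m
    rw [← inner_waveVector_eq_innerWave]
    have hn : ⟪f, e n⟫_ℂ = 0 := Submodule.inner_left_of_mem_orthogonal
      (Submodule.le_topologicalClosure _ (Submodule.subset_span (Set.mem_range_self n))) hf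
    simp only [e] at hn
    rw [inner_smul_right] at hn
    refine (mul_eq_zero.mp hn).resolve_left (inv_ne_zero ?_)
    exact Complex.ofReal_ne_zero.mpr (hpos n).ne'
  have key := hasSum_inner_mul_inner_of_mem_closure_span he (hmem l) (hmem m)
  rw [inner_waveVector_waveVector, sub_self, mul_comm] at key
  have key' : HasSum _ (waveElement ha 0 m l) := key
  convert key' using 2 with n
  have hsq : (√(laguerreNormSq a n) : ℂ) ^ 2 = laguerreNormSq a n := by
    rw [← Complex.ofReal_pow, Real.sq_sqrt (laguerreNormSq_pos ha n).le]
  simp only [e]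
  rw [inner_smul_left, inner_smul_right, inner_waveVector_waveVector, inner_waveVector_waveVector,
    ← Complex.ofReal_inv, Complex.conj_ofReal, Complex.ofReal_inv, ← hsq, zero_sub, sub_zero,
    conj_waveElement, waveElement_comm ha k, waveElement, waveElement]
  field_simp

end Completeness

/-! ### Asymptotics of the moments of a row -/

section Moments

variable {a : ℝ}

/-- The sum `∑ n, n ^ p * V m n * conj (V l n) / h n` over the matrix elements `V` of `e ^ (i k x)`
in the monic Laguerre polynomials, `h n` being their squared norms; it is defined through the
recursion that comes from `natCast_mul_waveElement`. -/
noncomputable def rowMoment (ha : -1 < a) (k : ℝ) : ℕ → ℕ → ℕ → ℂ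
  | 0, m, l => waveElement ha 0 m l
  | p + 1, m, l => (m + k ^ 2 * (2 * m + a + 1)) * rowMoment ha k p m l
      + (k ^ 2 + Complex.I * k) * rowMoment ha k p (m + 1) l
      + (k ^ 2 - Complex.I * k) * (m * (m + a)) * rowMoment ha k p (m - 1) l

lemma hasSum_rowMoment (ha : -1 < a) (k : ℝ) (p m l : ℕ) :
    HasSum (fun n : ℕ => (n : ℂ) ^ p *
      (waveElement ha k m n * (starRingEnd ℂ) (waveElement ha k l n) / laguerreNormSq a n))
      (rowMoment ha k p m l) := by
  induction p generalizing m with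
  | zero => simpa [rowMoment] using hasSum_waveElement_mul_conj ha k m l
  | succ p ih =>
    have h := (((ih m).mul_left ((m : ℂ) + k ^ 2 * (2 * m + a + 1))).add
      ((ih (m + 1)).mul_left ((k : ℂ) ^ 2 + Complex.I * k))).add
      ((ih (m - 1)).mul_left (((k : ℂ) ^ 2 - Complex.I * k) * (m * (m + a))))
    rw [rowMoment]
    refine Eq.mpr (congrArg (fun f : ℕ → ℂ => HasSum f _) (funext fun n => ?_)) h
    have e := natCast_mul_waveElement ha k m n
    rw [pow_succ]
    linear_combination ((n : ℂ) ^ p * (starRingEnd ℂ) (waveElement ha k l n)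
      / laguerreNormSq a n) * e

/-- The Fourier cosine coefficients of the powers of `1 + 2 k ^ 2 + 2 k √(1 + k ^ 2) cos θ`. -/
noncomputable def cosineMoment (k : ℝ) (p : ℕ) (t : ℝ) : ℝ :=
  Real.pi⁻¹ * ∫ θ in (0 : ℝ)..Real.pi,
    (1 + 2 * k ^ 2 + 2 * k * √(1 + k ^ 2) * Real.cos θ) ^ p * Real.cos (t * θ)

lemma cosineMoment_succ (k : ℝ) (p : ℕ) (t : ℝ) : cosineMoment k (p + 1) t =
    (1 + 2 * k ^ 2) * cosineMoment k p t
      + k * √(1 + k ^ 2) * (cosineMoment k p (t + 1) + cosineMoment k p (t - 1)) := by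
  have hi (t : ℝ) : IntervalIntegrable (fun θ =>
      (1 + 2 * k ^ 2 + 2 * k * √(1 + k ^ 2) * Real.cos θ) ^ p * Real.cos (t * θ)) volume
      0 Real.pi := by
    apply Continuous.intervalIntegrable
    fun_prop
  simp only [cosineMoment]
  have e : ∫ θ in (0 : ℝ)..Real.pi,
      (1 + 2 * k ^ 2 + 2 * k * √(1 + k ^ 2) * Real.cos θ) ^ (p + 1) * Real.cos (t * θ) =
      ∫ θ in (0 : ℝ)..Real.pi, ((1 + 2 * k ^ 2) *
        ((1 + 2 * k ^ 2 + 2 * k * √(1 + k ^ 2) * Real.cos θ) ^ p * Real.cos (t * θ))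
      + k * √(1 + k ^ 2) *
        ((1 + 2 * k ^ 2 + 2 * k * √(1 + k ^ 2) * Real.cos θ) ^ p * Real.cos ((t + 1) * θ)
        + (1 + 2 * k ^ 2 + 2 * k * √(1 + k ^ 2) * Real.cos θ) ^ p * Real.cos ((t - 1) * θ))) := by
    congr 1 with θ
    rw [add_mul t, sub_mul t, one_mul, Real.cos_add, Real.cos_sub]
    ring
  rw [e, intervalIntegral.integral_add ((hi t).const_mul _) (((hi _).add (hi _)).const_mul _),
    intervalIntegral.integral_const_mul, intervalIntegral.integral_const_mul,
    intervalIntegral.integral_add (hi _) (hi _)]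
  ring

lemma cosineMoment_zero_natCast_sub (k : ℝ) (i j : ℕ) :
    cosineMoment k 0 ((i : ℝ) - j) = if i = j then 1 else 0 := by
  simp only [cosineMoment, pow_zero, one_mul]
  split_ifs with h
  · subst h
    simp [Real.pi_ne_zero]
  · have hne : (i : ℝ) - j ≠ 0 := sub_ne_zero.mpr (by exact_mod_cast h)
    rw [intervalIntegral.integral_comp_mul_left (fun x => Real.cos x) hne, integral_cos]
    have : Real.sin (((i : ℝ) - j) * Real.pi) = 0 := by
      have := Real.sin_int_mul_pi ((i : ℤ) - j)
      push_cast at this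
      exact this
    rw [this]
    simp

lemma tendsto_natCast_add_div (c : ℝ) :
    Tendsto (fun m : ℕ => ((m : ℝ) + c) / m) atTop (𝓝 1) := by
  have h : Tendsto (fun m : ℕ => 1 + c / (m : ℝ)) atTop (𝓝 (1 + 0)) :=
    tendsto_const_nhds.add (tendsto_const_div_atTop_nhds_zero_nat c)
  rw [add_zero] at h
  refine h.congr' ?_
  filter_upwards [eventually_gt_atTop 0] with m hm
  have : (m : ℝ) ≠ 0 := by positivity
  field_simp

lemma tendsto_laguerreNormSq_ratio (ha : -1 < a) (i : ℕ) :
    Tendsto (fun m : ℕ => laguerreNormSq a (m + i) / ((m : ℝ) ^ (2 * i) * laguerreNormSq a m))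
      atTop (𝓝 1) := by
  induction i with
  | zero =>
    refine tendsto_const_nhds.congr fun m => ?_
    simp [(laguerreNormSq_pos ha m).ne']
  | succ i ih =>
    have h := ((tendsto_natCast_add_div ((i : ℝ) + 1)).mul
      (tendsto_natCast_add_div ((i : ℝ) + 1 + a))).mul ih
    simp only [one_mul] at h
    refine h.congr' ?_
    filter_upwards [eventually_gt_atTop 0] with m hm
    have hm' : (m : ℝ) ≠ 0 := by positivity
    have hh := (laguerreNormSq_pos ha m).ne'
    have e : laguerreNormSq a (m + (i + 1)) = ((m + i : ℕ) + 1) * (((m + i : ℕ) : ℝ) + 1 + a) *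
        laguerreNormSq a (m + i) := rfl
    rw [e]
    push_cast
    field_simp
    ring

/-- The entries of the moment matrices near the diagonal, in the scaling of large indices. The
index `m + i` only reaches down to `m` in `p ≤ i` steps of the recursion, which keeps it away from
the boundary of the matrix. -/
lemma tendsto_rowMoment (ha : -1 < a) {k : ℝ} (p i j : ℕ) (hp : p ≤ i) :
    Tendsto (fun m : ℕ => rowMoment ha k p (m + i) (m + j)
        / ((m : ℂ) ^ (p + i + j) * laguerreNormSq a m)) atTop
      (𝓝 (((k - Complex.I) / (√(1 + k ^ 2) : ℝ)) ^ i * ((k + Complex.I) / (√(1 + k ^ 2) : ℝ)) ^ j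
        * cosineMoment k p ((i : ℝ) - j))) := by
  set s : ℝ := √(1 + k ^ 2) with hs
  have hs0 : (s : ℂ) ≠ 0 := Complex.ofReal_ne_zero.mpr (by positivity)
  have hs2 : (s : ℂ) ^ 2 = 1 + k ^ 2 := by
    rw [← Complex.ofReal_pow, hs, Real.sq_sqrt (by positivity)]; push_cast; ring
  have hunit : ((k - Complex.I) / (s : ℂ)) * ((k + Complex.I) / s) = 1 := by
    field_simp
    linear_combination -hs2 - Complex.I_sq
  induction p generalizing i with
  | zero =>
    simp only [rowMoment, cosineMoment_zero_natCast_sub]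
    by_cases hij : i = j
    · subst hij
      have h := (Complex.continuous_ofReal.tendsto 1).comp (tendsto_laguerreNormSq_ratio ha i)
      rw [if_pos rfl, ← mul_pow, hunit]
      simp only [one_pow, one_mul]
      refine h.congr fun m => ?_
      simp only [Function.comp_apply, waveElement_zero_self]
      push_cast
      congr 3
      ring
    · have hz (m : ℕ) : waveElement ha 0 (m + i) (m + j) = 0 :=
        waveElement_zero_of_ne ha (by omega)
      simp [hz, hij]
  | succ p ih =>
    obtain ⟨i, rfl⟩ : ∃ i', i = i' + 1 := ⟨i - 1, by omega⟩
    have c0 : Tendsto (fun m : ℕ => ((((m : ℝ) + ((i : ℝ) + 1)) / m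
        + k ^ 2 * (2 * (((m : ℝ) + ((i : ℝ) + 1 + (a + 1) / 2)) / m)) : ℝ) : ℂ)) atTop
        (𝓝 ((1 + k ^ 2 * (2 * 1) : ℝ) : ℂ)) :=
      (Complex.continuous_ofReal.tendsto _).comp ((tendsto_natCast_add_div _).add
        (((tendsto_natCast_add_div _).const_mul _).const_mul _))
    have c1 : Tendsto (fun m : ℕ => (((((m : ℝ) + ((i : ℝ) + 1)) / m)
        * (((m : ℝ) + ((i : ℝ) + 1 + a)) / m) : ℝ) : ℂ)) atTop (𝓝 ((1 * 1 : ℝ) : ℂ)) :=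
      (Complex.continuous_ofReal.tendsto _).comp
        ((tendsto_natCast_add_div _).mul (tendsto_natCast_add_div _))
    have h := ((c0.mul (ih (i + 1) (by omega))).add
      ((ih (i + 1 + 1) (by omega)).const_mul ((k : ℂ) ^ 2 + Complex.I * k))).add
      ((c1.mul (ih i (by omega))).const_mul ((k : ℂ) ^ 2 - Complex.I * k))
    have hlim : ∀ z w : ℂ, z = w → ∀ f : ℕ → ℂ, Tendsto f atTop (𝓝 z) → Tendsto f atTop (𝓝 w) :=
      fun z w e f hf => e ▸ hf
    refine hlim _ _ ?_ _ (h.congr' ?_)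
    -- the two off-diagonal limits become equal after the phases are absorbed
    · rw [cosineMoment_succ, ← hs]
      have t1 : (((i + 1 + 1 : ℕ) : ℝ) - j) = ((i + 1 : ℕ) : ℝ) - j + 1 := by push_cast; ring
      have t2 : ((i : ℝ) - j) = ((i + 1 : ℕ) : ℝ) - j - 1 := by push_cast; ring
      rw [t1, t2]
      set d := cosineMoment k p (((i + 1 : ℕ) : ℝ) - j)
      set d1 := cosineMoment k p (((i + 1 : ℕ) : ℝ) - j + 1)
      set d2 := cosineMoment k p (((i + 1 : ℕ) : ℝ) - j - 1)
      have u1 : ((k : ℂ) ^ 2 + Complex.I * k) * ((k - Complex.I) / s) = k * s := by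
        field_simp
        linear_combination -hs2 * k - k * Complex.I_sq
      have u2 : ((k : ℂ) ^ 2 - Complex.I * k) = k * s * ((k - Complex.I) / s) := by
        field_simp
      set u := ((k : ℂ) - Complex.I) / s
      set v := ((k : ℂ) + Complex.I) / s
      push_cast
      linear_combination (u ^ (i + 1) * v ^ j * d1) * u1 + (u ^ i * v ^ j * d2) * u2
    · filter_upwards [eventually_gt_atTop 0] with m hm
      have hm' : (m : ℂ) ≠ 0 := by exact_mod_cast hm.ne'
      have hh : (laguerreNormSq a m : ℂ) ≠ 0 :=
        Complex.ofReal_ne_zero.mpr (laguerreNormSq_pos ha m).ne'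
      rw [rowMoment, show m + (i + 1) + 1 = m + (i + 1 + 1) by ring,
        show m + (i + 1) - 1 = m + i by omega]
      push_cast
      field_simp
      ring

end Moments

/-! ### The method of moments -/

section MethodOfMoments

open Polynomial

lemma exists_abs_eval_le (q : ℝ[X]) :
    ∃ D : ℝ, 0 ≤ D ∧ ∃ n : ℕ, ∀ x : ℝ, 1 ≤ |x| → |q.eval x| ≤ D * x ^ (2 * n) := by
  refine ⟨∑ i ∈ Finset.range (q.natDegree + 1), |q.coeff i|,
    Finset.sum_nonneg fun i _ => abs_nonneg _, q.natDegree, fun x hx => ?_⟩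
  rw [eval_eq_sum_range, Finset.sum_mul]
  refine (Finset.abs_sum_le_sum_abs _ _).trans (Finset.sum_le_sum fun i hi => ?_)
  rw [abs_mul, abs_pow, ← Even.pow_abs (even_two_mul _)]
  rw [Finset.mem_range] at hi
  exact mul_le_mul_of_nonneg_left (pow_le_pow_right₀ hx (by omega)) (abs_nonneg _)

/-- Integrating a polynomial approximation of `f` on `[-2 R, 2 R]` costs its error and a high
moment, which controls the complement of the interval. -/
lemma abs_integral_sub_integral_le {ν : Measure ℝ} [IsProbabilityMeasure ν]
    (hν : ∀ p : ℕ, Integrable (fun x => x ^ p) ν) {f g : ℝ → ℝ} (hf : Integrable f ν)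
    (hg : Integrable g ν) {R ε D : ℝ} (hR : 0 < R) (hε : 0 ≤ ε) (hD : 0 ≤ D) {n : ℕ}
    (hin : ∀ x, |x| ≤ 2 * R → |f x - g x| ≤ ε)
    (hout : ∀ x, 2 * R ≤ |x| → |f x - g x| ≤ D * x ^ (2 * n)) (j : ℕ) :
    |∫ x, f x ∂ν - ∫ x, g x ∂ν| ≤
      ε + D / (2 * R) ^ (2 * j) * ∫ x, x ^ (2 * (n + j)) ∂ν := by
  rw [← integral_sub hf hg]
  have hb : ∫ x, (ε + D / (2 * R) ^ (2 * j) * x ^ (2 * (n + j))) ∂ν =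
      ε + D / (2 * R) ^ (2 * j) * ∫ x, x ^ (2 * (n + j)) ∂ν := by
    rw [integral_add (integrable_const _) ((hν _).const_mul _), integral_const_mul]
    simp
  rw [← hb]
  refine (abs_integral_le_integral_abs).trans (integral_mono (hf.sub hg).abs
    ((integrable_const _).add ((hν _).const_mul _)) fun x => ?_)
  have hpow (i : ℕ) : 0 ≤ x ^ (2 * i) := (even_two_mul i).pow_nonneg x
  rcases le_total |x| (2 * R) with h | h
  · have := hin x h
    have h2 : 0 ≤ D / (2 * R) ^ (2 * j) * x ^ (2 * (n + j)) :=
      mul_nonneg (by positivity) (hpow _)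
    simp only
    linarith
  · have h1 := hout x h
    have h3 : (2 * R) ^ (2 * j) ≤ x ^ (2 * j) := by
      rw [← Even.pow_abs (even_two_mul j) x]
      exact pow_le_pow_left₀ (by positivity) h _
    have h2 : D * x ^ (2 * n) ≤ D / (2 * R) ^ (2 * j) * x ^ (2 * (n + j)) := by
      rw [div_mul_eq_mul_div, le_div_iff₀ (by positivity), mul_add, pow_add, ← mul_assoc]
      exact mul_le_mul_of_nonneg_left h3 (mul_nonneg hD (hpow n))
    simp only
    linarith

/-- Convergence of all moments to those of a compactly supported probability measure implies weak
convergence. -/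
theorem tendsto_probabilityMeasure_of_tendsto_moments {μs : ℕ → ProbabilityMeasure ℝ}
    {μ : ProbabilityMeasure ℝ} {R : ℝ} (hR : 1 ≤ R) (hμ : ∀ᵐ x ∂(μ : Measure ℝ), |x| ≤ R)
    (hint : ∀ (N p : ℕ), Integrable (fun x => x ^ p) (μs N : Measure ℝ))
    (hmom : ∀ p : ℕ, Tendsto (fun N => ∫ x, x ^ p ∂(μs N : Measure ℝ)) atTop
      (𝓝 (∫ x, x ^ p ∂(μ : Measure ℝ)))) : Tendsto μs atTop (𝓝 μ) := by
  have hR0 : 0 < R := by linarith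
  have hintμ (p : ℕ) : Integrable (fun x => x ^ p) (μ : Measure ℝ) := by
    refine Integrable.of_bound (by fun_prop) (R ^ p) ?_
    filter_upwards [hμ] with x hx
    rw [norm_pow, Real.norm_eq_abs]
    exact pow_le_pow_left₀ (abs_nonneg x) hx p
  have hintpoly {ν : Measure ℝ} (h : ∀ p : ℕ, Integrable (fun x => x ^ p) ν) (q : ℝ[X]) :
      Integrable (fun x => q.eval x) ν := by
    simp only [eval_eq_sum_range]
    exact integrable_finsetSum _ fun i _ => (h i).const_mul _
  have hpoly (q : ℝ[X]) : Tendsto (fun N => ∫ x, q.eval x ∂(μs N : Measure ℝ)) atTop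
      (𝓝 (∫ x, q.eval x ∂(μ : Measure ℝ))) := by
    simp only [eval_eq_sum_range]
    rw [integral_finsetSum _ fun i _ => (hintμ i).const_mul _]
    have e (N : ℕ) : ∫ x, ∑ i ∈ Finset.range (q.natDegree + 1), q.coeff i * x ^ i
        ∂(μs N : Measure ℝ) = ∑ i ∈ Finset.range (q.natDegree + 1),
          ∫ x, q.coeff i * x ^ i ∂(μs N : Measure ℝ) :=
      integral_finsetSum _ fun i _ => (hint N i).const_mul _
    simp only [e, integral_const_mul]
    exact tendsto_finsetSum _ fun i _ => (hmom i).const_mul _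
  rw [ProbabilityMeasure.tendsto_iff_forall_integral_tendsto]
  intro f
  rw [Metric.tendsto_atTop']
  intro δ hδ
  set ε := δ / 6 with hε
  have hε0 : 0 < ε := by positivity
  obtain ⟨q, hq⟩ := exists_polynomial_near_of_continuousOn (-(2 * R)) (2 * R) f
    f.continuous.continuousOn ε hε0
  obtain ⟨D, hD, n, hDn⟩ := exists_abs_eval_le q
  have hin (x : ℝ) (hx : |x| ≤ 2 * R) : |f x - q.eval x| ≤ ε := by
    rw [abs_sub_comm]; exact (hq x (abs_le.mp hx)).le
  have hout (x : ℝ) (hx : 2 * R ≤ |x|) : |f x - q.eval x| ≤ (‖f‖ + D) * x ^ (2 * n) := by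
    have hx1 : 1 ≤ |x| := by linarith
    have h1 : 1 ≤ x ^ (2 * n) := by
      rw [← Even.pow_abs (even_two_mul n) x]; exact one_le_pow₀ hx1
    have h2 : |f x| ≤ ‖f‖ := f.norm_coe_le_norm x
    have h3 := hDn x hx1
    have h4 := abs_sub (f x) (q.eval x)
    nlinarith [norm_nonneg f]
  have hD' : 0 ≤ ‖f‖ + D := by positivity
  have key {ν : Measure ℝ} [IsProbabilityMeasure ν] (h : ∀ p : ℕ, Integrable (fun x => x ^ p) ν)
      (j : ℕ) := abs_integral_sub_integral_le h (f.integrable ν) (hintpoly h q) hR0 hε0.le hD'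
        hin hout j
  obtain ⟨j, hj⟩ : ∃ j : ℕ, (‖f‖ + D) * R ^ (2 * n) * (1 / 4 : ℝ) ^ j < ε := by
    have h := (tendsto_pow_atTop_nhds_zero_of_lt_one (r := (1 / 4 : ℝ)) (by norm_num)
      (by norm_num)).const_mul ((‖f‖ + D) * R ^ (2 * n))
    rw [mul_zero] at h
    exact (h.eventually (gt_mem_nhds hε0)).exists
  have hlimit : (‖f‖ + D) / (2 * R) ^ (2 * j) * ∫ x, x ^ (2 * (n + j)) ∂(μ : Measure ℝ) < ε := by
    have h1 : ∫ x, x ^ (2 * (n + j)) ∂(μ : Measure ℝ) ≤ R ^ (2 * (n + j)) := by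
      have : ∫ _, R ^ (2 * (n + j)) ∂(μ : Measure ℝ) = R ^ (2 * (n + j)) := by simp
      rw [← this]
      refine integral_mono_ae (hintμ _) (integrable_const _) ?_
      filter_upwards [hμ] with x hx
      rw [← Even.pow_abs (even_two_mul (n + j)) x]
      exact pow_le_pow_left₀ (abs_nonneg x) hx _
    refine lt_of_le_of_lt (mul_le_mul_of_nonneg_left h1 (by positivity)) (lt_of_eq_of_lt ?_ hj)
    rw [mul_add 2 n j, pow_add, pow_mul (2 * R), mul_pow, mul_pow, pow_mul R 2 j, one_div, inv_pow]
    norm_num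
    field_simp
  have hev := ((hmom (2 * (n + j))).const_mul ((‖f‖ + D) / (2 * R) ^ (2 * j))).eventually
    (gt_mem_nhds hlimit)
  have hev2 := (Metric.tendsto_atTop'.mp (hpoly q)) ε hε0
  obtain ⟨N1, hN1⟩ := hev2
  obtain ⟨N2, hN2⟩ := eventually_atTop.mp hev
  refine ⟨max N1 N2, fun N hN => ?_⟩
  have b1 := key (hint N) j
  have b2 := key hintμ j
  have b3 := hN1 N (lt_of_le_of_lt (le_max_left _ _) hN)
  have b4 := hN2 N ((le_max_right _ _).trans hN.le)
  rw [Real.dist_eq] at b3 ⊢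
  rw [abs_le] at b1 b2
  rw [abs_lt] at b3 ⊢
  constructor <;> linarith

end MethodOfMoments

/-! ### The limiting law of a row -/

section LimitLaw

/-- The law of `1 + 2 k ^ 2 + 2 k √(1 + k ^ 2) cos θ` with `θ` uniform on `(0, π)`: the value at time
`k` of a classical action variable that starts from `1` with a uniform phase. -/
noncomputable def limitLaw (k : ℝ) : Measure ℝ :=
  (ENNReal.ofReal Real.pi⁻¹ • volume.restrict (Set.Ioc 0 Real.pi)).map
    fun θ => 1 + 2 * k ^ 2 + 2 * k * √(1 + k ^ 2) * Real.cos θ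

lemma measurable_action (k : ℝ) :
    Measurable fun θ => 1 + 2 * k ^ 2 + 2 * k * √(1 + k ^ 2) * Real.cos θ := by
  fun_prop

lemma limitLaw_apply (k : ℝ) {s : Set ℝ} (hs : MeasurableSet s) :
    limitLaw k s = ENNReal.ofReal Real.pi⁻¹ * volume
      ((fun θ => 1 + 2 * k ^ 2 + 2 * k * √(1 + k ^ 2) * Real.cos θ) ⁻¹' s ∩ Set.Ioc 0 Real.pi) := by
  rw [limitLaw, Measure.map_apply (measurable_action k) hs, Measure.smul_apply,
    Measure.restrict_apply (measurable_action k hs), smul_eq_mul]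

instance isProbabilityMeasure_limitLaw (k : ℝ) : IsProbabilityMeasure (limitLaw k) := by
  constructor
  rw [limitLaw_apply k MeasurableSet.univ, Set.preimage_univ, Set.univ_inter, Real.volume_Ioc,
    sub_zero, ← ENNReal.ofReal_mul (by positivity), inv_mul_cancel₀ Real.pi_ne_zero,
    ENNReal.ofReal_one]

lemma integral_pow_limitLaw (k : ℝ) (p : ℕ) : ∫ x, x ^ p ∂limitLaw k = cosineMoment k p 0 := by
  rw [limitLaw, integral_map (measurable_action k).aemeasurable
    (by fun_prop), integral_smul_measure, cosineMoment,
    intervalIntegral.integral_of_le Real.pi_pos.le,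
    ENNReal.toReal_ofReal (by positivity), smul_eq_mul]
  simp

lemma ae_abs_le_limitLaw (k : ℝ) :
    ∀ᵐ x ∂limitLaw k, |x| ≤ 1 + 2 * k ^ 2 + |2 * k * √(1 + k ^ 2)| := by
  rw [limitLaw, ae_map_iff (measurable_action k).aemeasurable
    (measurableSet_le (by fun_prop) (by fun_prop))]
  refine Eventually.of_forall fun θ => ?_
  refine (abs_add_le _ _).trans (add_le_add (le_of_eq (abs_of_nonneg (by positivity))) ?_)
  rw [abs_mul]
  exact mul_le_of_le_one_right (abs_nonneg _) (Real.abs_cos_le_one θ)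

/-- The action of `limitLaw` has decreased exactly for the phases beyond `π / 2 + arctan k`. -/
lemma action_lt_one_iff {k : ℝ} (hk : 0 < k) {θ : ℝ} (hθ : θ ∈ Set.Ioc 0 Real.pi) :
    (1 + 2 * k ^ 2 + 2 * k * √(1 + k ^ 2) * Real.cos θ < 1 ↔ Real.pi / 2 + Real.arctan k < θ) ∧
    (1 + 2 * k ^ 2 + 2 * k * √(1 + k ^ 2) * Real.cos θ = 1 → θ = Real.pi / 2 + Real.arctan k) := by
  have hs : 0 < √(1 + k ^ 2) := by positivity
  have hc : Real.cos (Real.pi / 2 + Real.arctan k) * √(1 + k ^ 2) = -k := by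
    rw [add_comm, Real.cos_add_pi_div_two, Real.sin_arctan]
    field_simp
  have hmem : Real.pi / 2 + Real.arctan k ∈ Set.Icc 0 Real.pi := by
    have h1 := Real.arctan_lt_pi_div_two k
    have h2 := Real.neg_pi_div_two_lt_arctan k
    constructor <;> linarith
  have e : 1 + 2 * k ^ 2 + 2 * k * √(1 + k ^ 2) * Real.cos θ - 1 =
      2 * k * √(1 + k ^ 2) * (Real.cos θ - Real.cos (Real.pi / 2 + Real.arctan k)) := by
    linear_combination (2 * k) * hc
  have hpos : 0 < 2 * k * √(1 + k ^ 2) := by positivity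
  have hθ' : θ ∈ Set.Icc 0 Real.pi := ⟨hθ.1.le, hθ.2⟩
  constructor
  · rw [← Real.strictAntiOn_cos.lt_iff_gt hθ' hmem, ← sub_neg, e, ← sub_neg (a := Real.cos θ)]
    exact ⟨fun h => lt_of_not_ge fun h' => absurd (mul_nonneg hpos.le h') (not_le.mpr h),
      fun h => mul_neg_of_pos_of_neg hpos h⟩
  · intro h
    rw [← sub_eq_zero, e] at h
    exact Real.injOn_cos hθ' hmem (sub_eq_zero.mp ((mul_eq_zero.mp h).resolve_left hpos.ne'))

lemma limitLaw_Iio_one {k : ℝ} (hk : 0 < k) :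
    limitLaw k (Set.Iio 1) = ENNReal.ofReal (1 / 2 - Real.arctan k / Real.pi) := by
  have e : (fun θ => 1 + 2 * k ^ 2 + 2 * k * √(1 + k ^ 2) * Real.cos θ) ⁻¹' Set.Iio 1
      ∩ Set.Ioc 0 Real.pi = Set.Ioc (Real.pi / 2 + Real.arctan k) Real.pi := by
    ext θ
    simp only [Set.mem_inter_iff, Set.mem_preimage, Set.mem_Iio]
    constructor
    · rintro ⟨h1, h2⟩
      exact ⟨(action_lt_one_iff hk h2).1.mp h1, h2.2⟩
    · intro h
      have h2 : θ ∈ Set.Ioc 0 Real.pi :=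
        ⟨by linarith [h.1, Real.neg_pi_div_two_lt_arctan k], h.2⟩
      exact ⟨(action_lt_one_iff hk h2).1.mpr h.1, h2⟩
  rw [limitLaw_apply k measurableSet_Iio, e, Real.volume_Ioc,
    ← ENNReal.ofReal_mul (by positivity)]
  congr 1
  field_simp
  ring

lemma limitLaw_singleton_one {k : ℝ} (hk : 0 < k) : limitLaw k {1} = 0 := by
  rw [limitLaw_apply k (measurableSet_singleton 1)]
  refine mul_eq_zero_of_right _ (measure_mono_null (t := {Real.pi / 2 + Real.arctan k}) ?_
    (by simp))
  rintro θ ⟨h1, h2⟩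
  exact (action_lt_one_iff hk h2).2 h1

lemma limitLaw_Iic_one {k : ℝ} (hk : 0 < k) :
    limitLaw k (Set.Iic 1) = ENNReal.ofReal (1 / 2 - Real.arctan k / Real.pi) := by
  rw [← Set.Iio_union_right, measure_union (by simp) (measurableSet_singleton 1),
    limitLaw_singleton_one hk, add_zero, limitLaw_Iio_one hk]

end LimitLaw

section RowLaw

variable {a : ℝ}

lemma norm_sq_waveMatrix (ha : -1 < a) (k : ℝ) (m n : ℕ) :
    ((‖waveMatrix ha k m n‖ ^ 2 : ℝ) : ℂ) = (waveElement ha k m n *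
      (starRingEnd ℂ) (waveElement ha k m n) / laguerreNormSq a n) / laguerreNormSq a m := by
  have h1 : (√(laguerreNormSq a m) : ℂ) ^ 2 = laguerreNormSq a m := by
    rw [← Complex.ofReal_pow, Real.sq_sqrt (laguerreNormSq_pos ha m).le]
  have h2 : (√(laguerreNormSq a n) : ℂ) ^ 2 = laguerreNormSq a n := by
    rw [← Complex.ofReal_pow, Real.sq_sqrt (laguerreNormSq_pos ha n).le]
  rw [Complex.ofReal_pow, ← Complex.mul_conj', waveMatrix, map_div₀, Complex.conj_ofReal,
    ← h1, ← h2]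
  push_cast
  field_simp

lemma hasSum_pow_mul_norm_sq_waveMatrix (ha : -1 < a) (k : ℝ) (p m : ℕ) :
    HasSum (fun n : ℕ => ‖waveMatrix ha k m n‖ ^ 2 * ((n : ℝ) / m) ^ p)
      (rowMoment ha k p m m / ((m : ℂ) ^ p * laguerreNormSq a m)).re := by
  have h := Complex.hasSum_re ((hasSum_rowMoment ha k p m m).div_const
    ((m : ℂ) ^ p * laguerreNormSq a m))
  refine Eq.mpr (congrArg (fun f : ℕ → ℝ => HasSum f _) (funext fun n => ?_)) h
  rw [← Complex.ofReal_re (‖waveMatrix ha k m n‖ ^ 2 * ((n : ℝ) / m) ^ p), Complex.ofReal_mul,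
    norm_sq_waveMatrix]
  congr 1
  push_cast
  rw [div_pow]
  simp only [div_eq_mul_inv, mul_inv]
  ring

/-- The probability measure with mass `|U m n| ^ 2` at `n / m`, where `U` is the matrix of
`e ^ (i k x)` in the orthonormal Laguerre system. -/
noncomputable def rowLaw (ha : -1 < a) (k : ℝ) (m : ℕ) : Measure ℝ :=
  Measure.sum fun n : ℕ => ENNReal.ofReal (‖waveMatrix ha k m n‖ ^ 2) • Measure.dirac ((n : ℝ) / m)

lemma summable_rowLaw_pow (ha : -1 < a) (k : ℝ) (m p : ℕ) :
    Summable fun n : ℕ => (ENNReal.ofReal (‖waveMatrix ha k m n‖ ^ 2)).toReal *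
      ‖((n : ℝ) / m) ^ p‖ := by
  refine (hasSum_pow_mul_norm_sq_waveMatrix ha k p m).summable.congr fun n => ?_
  rw [ENNReal.toReal_ofReal (by positivity), Real.norm_of_nonneg (by positivity)]

lemma integrable_pow_rowLaw (ha : -1 < a) (k : ℝ) (m p : ℕ) :
    Integrable (fun x => x ^ p) (rowLaw ha k m) :=
  integrable_sum_dirac (fun _ => ENNReal.ofReal_ne_top) (summable_rowLaw_pow ha k m p)

lemma integral_pow_rowLaw (ha : -1 < a) (k : ℝ) (m p : ℕ) :
    ∫ x, x ^ p ∂rowLaw ha k m =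
      (rowMoment ha k p m m / ((m : ℂ) ^ p * laguerreNormSq a m)).re := by
  rw [rowLaw, integral_sum_dirac (fun _ => ENNReal.ofReal_ne_top),
    ← (hasSum_pow_mul_norm_sq_waveMatrix ha k p m).tsum_eq]
  refine tsum_congr fun n => ?_
  rw [ENNReal.toReal_ofReal (by positivity), smul_eq_mul]

instance isProbabilityMeasure_rowLaw (ha : -1 < a) (k : ℝ) (m : ℕ) :
    IsProbabilityMeasure (rowLaw ha k m) := by
  constructor
  have h := hasSum_pow_mul_norm_sq_waveMatrix ha k 0 m
  have hval : (rowMoment ha k 0 m m / ((m : ℂ) ^ 0 * laguerreNormSq a m)).re = 1 := by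
    rw [rowMoment, waveElement_zero_self, pow_zero, one_mul,
      div_self (Complex.ofReal_ne_zero.mpr (laguerreNormSq_pos ha m).ne'), Complex.one_re]
  rw [hval] at h
  simp only [pow_zero, mul_one] at h
  rw [rowLaw, Measure.sum_apply _ MeasurableSet.univ]
  simp only [Measure.smul_apply, measure_univ, smul_eq_mul, mul_one]
  rw [← ENNReal.ofReal_tsum_of_nonneg (fun n => by positivity) h.summable, h.tsum_eq,
    ENNReal.ofReal_one]

/-- `tendsto_rowMoment` on the diagonal, in the row `m + p`; the phases cancel there. -/
lemma tendsto_integral_pow_rowLaw (ha : -1 < a) (k : ℝ) (p : ℕ) :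
    Tendsto (fun m => ∫ x, x ^ p ∂rowLaw ha k m) atTop (𝓝 (∫ x, x ^ p ∂limitLaw k)) := by
  rw [integral_pow_limitLaw, ← tendsto_add_atTop_iff_nat p]
  simp only [integral_pow_rowLaw]
  have h := tendsto_rowMoment ha (k := k) p p p le_rfl
  have hunit : ((k - Complex.I) / (√(1 + k ^ 2) : ℝ)) ^ p *
      ((k + Complex.I) / (√(1 + k ^ 2) : ℝ)) ^ p = 1 := by
    have hs0 : ((√(1 + k ^ 2) : ℝ) : ℂ) ≠ 0 := Complex.ofReal_ne_zero.mpr (by positivity)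
    have hs2 : ((√(1 + k ^ 2) : ℝ) : ℂ) ^ 2 = 1 + k ^ 2 := by
      rw [← Complex.ofReal_pow, Real.sq_sqrt (by positivity)]; push_cast; ring
    rw [← mul_pow, div_mul_div_comm, ← sq (Complex.ofReal _), hs2,
      show ((k : ℂ) - Complex.I) * (k + Complex.I) = 1 + k ^ 2 by
        linear_combination -Complex.I_sq, div_self (by rw [← hs2]; exact pow_ne_zero 2 hs0),
      one_pow]
  rw [hunit, one_mul, sub_self] at h
  have h1 : Tendsto (fun m : ℕ => (((((m : ℝ) + p) / m) ^ p *
      (laguerreNormSq a (m + p) / ((m : ℝ) ^ (2 * p) * laguerreNormSq a m)) : ℝ) : ℂ))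
      atTop (𝓝 ((1 ^ p * 1 : ℝ) : ℂ)) :=
    (Complex.continuous_ofReal.tendsto _).comp
      (((tendsto_natCast_add_div p).pow p).mul (tendsto_laguerreNormSq_ratio ha p))
  have h2 := h.div h1 (by simp)
  rw [one_pow, one_mul, Complex.ofReal_one, div_one] at h2
  have h3 := (Complex.continuous_re.tendsto _).comp h2
  rw [Complex.ofReal_re] at h3
  refine h3.congr' ?_
  filter_upwards [eventually_gt_atTop 0] with m hm
  have hm' : (m : ℂ) ≠ 0 := by exact_mod_cast hm.ne'
  have hmp : (m : ℂ) + p ≠ 0 := by exact_mod_cast (show m + p ≠ 0 by omega)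
  have hh : (laguerreNormSq a m : ℂ) ≠ 0 :=
    Complex.ofReal_ne_zero.mpr (laguerreNormSq_pos ha m).ne'
  have hh' : (laguerreNormSq a (m + p) : ℂ) ≠ 0 :=
    Complex.ofReal_ne_zero.mpr (laguerreNormSq_pos ha (m + p)).ne'
  simp only [Function.comp_apply, Pi.div_apply]
  congr 1
  push_cast
  rw [div_pow]
  field_simp
  ring

/-- `rowLaw` as a point of the space of probability measures. -/
noncomputable def rowProbability (ha : -1 < a) (k : ℝ) (m : ℕ) : ProbabilityMeasure ℝ :=
  ⟨rowLaw ha k m, inferInstance⟩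

/-- `limitLaw` as a point of the space of probability measures. -/
noncomputable def limitProbability (k : ℝ) : ProbabilityMeasure ℝ :=
  ⟨limitLaw k, inferInstance⟩

lemma tendsto_rowProbability (ha : -1 < a) (k : ℝ) :
    Tendsto (rowProbability ha k) atTop (𝓝 (limitProbability k)) :=
  tendsto_probabilityMeasure_of_tendsto_moments
    (R := 1 + 2 * k ^ 2 + |2 * k * √(1 + k ^ 2)|)
    (by have := abs_nonneg (2 * k * √(1 + k ^ 2)); nlinarith [sq_nonneg k])
    (ae_abs_le_limitLaw k) (fun m p => integrable_pow_rowLaw ha k m p)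
    (tendsto_integral_pow_rowLaw ha k)

lemma rowLaw_apply_eq_sum (ha : -1 < a) (k : ℝ) (m : ℕ) {s : Set ℝ} (hs : MeasurableSet s) {M : ℕ}
    (hM : ∀ n : ℕ, (n : ℝ) / m ∈ s ↔ n < M) :
    (rowLaw ha k m s).toReal = ∑ n ∈ Finset.range M, ‖waveMatrix ha k m n‖ ^ 2 := by
  rw [rowLaw, Measure.sum_apply _ hs, tsum_eq_sum (s := Finset.range M) fun n hn => ?_,
    ENNReal.toReal_sum fun n hn => ?_]
  · refine Finset.sum_congr rfl fun n hn => ?_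
    rw [Measure.smul_apply, Measure.dirac_apply' _ hs,
      Set.indicator_of_mem ((hM n).mpr (Finset.mem_range.mp hn))]
    simp
  · rw [Measure.smul_apply]
    exact ENNReal.mul_ne_top ENNReal.ofReal_ne_top (measure_ne_top _ _)
  · rw [Measure.smul_apply, Measure.dirac_apply' _ hs,
      Set.indicator_of_notMem fun h => hn (Finset.mem_range.mpr ((hM n).mp h))]
    simp

/-- A row of the matrix of `e ^ (i k x)` carries asymptotically the mass `1 / 2 - arctan k / π` to
the left of the diagonal, and the diagonal itself carries none. -/
lemma tendsto_sum_row (ha : -1 < a) {k : ℝ} (hk : 0 < k) :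
    Tendsto (fun m : ℕ => ∑ n ∈ Finset.range m, ‖waveMatrix ha k m n‖ ^ 2) atTop
      (𝓝 (1 / 2 - Real.arctan k / Real.pi)) ∧
    Tendsto (fun m : ℕ => ∑ n ∈ Finset.range (m + 1), ‖waveMatrix ha k m n‖ ^ 2) atTop
      (𝓝 (1 / 2 - Real.arctan k / Real.pi)) := by
  have hnn : 0 ≤ 1 / 2 - Real.arctan k / Real.pi := by
    have := Real.arctan_lt_pi_div_two k
    rw [sub_nonneg, div_le_iff₀ Real.pi_pos]
    linarith
  have h1 := ProbabilityMeasure.tendsto_measure_of_null_frontier_of_tendsto'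
    (tendsto_rowProbability ha k) (E := Set.Iio 1) (by
      rw [frontier_Iio]; exact limitLaw_singleton_one hk)
  have h2 := ProbabilityMeasure.tendsto_measure_of_null_frontier_of_tendsto'
    (tendsto_rowProbability ha k) (E := Set.Iic 1) (by
      rw [frontier_Iic]; exact limitLaw_singleton_one hk)
  simp only [limitProbability, ProbabilityMeasure.coe_mk, limitLaw_Iio_one hk,
    limitLaw_Iic_one hk] at h1 h2
  have h1' := (ENNReal.tendsto_toReal ENNReal.ofReal_ne_top).comp h1
  have h2' := (ENNReal.tendsto_toReal ENNReal.ofReal_ne_top).comp h2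
  rw [ENNReal.toReal_ofReal hnn] at h1' h2'
  constructor
  · refine h1'.congr' ?_
    filter_upwards [eventually_gt_atTop 0] with m hm
    refine rowLaw_apply_eq_sum ha k m measurableSet_Iio fun n => ?_
    rw [Set.mem_Iio, div_lt_one (by exact_mod_cast hm), Nat.cast_lt]
  · refine h2'.congr' ?_
    filter_upwards [eventually_gt_atTop 0] with m hm
    refine rowLaw_apply_eq_sum ha k m measurableSet_Iic fun n => ?_
    rw [Set.mem_Iic, div_le_one (by exact_mod_cast hm), Nat.cast_le, Nat.lt_succ_iff]

end RowLaw

/-! ### The limit of the structure function -/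

section Limit

variable {a : ℝ}

/-- The increments of the structure function in `N`, in terms of the mass of the `N`-th row to the left
of the diagonal. -/
lemma structureFunction_laguerre_eq_sum (ha : -1 < a) (N : ℕ) (k : ℝ) :
    structureFunction (laguerreWeight a) N k =
      ∑ m ∈ Finset.range N, (1 - (∑ n ∈ Finset.range m, ‖waveMatrix ha k m n‖ ^ 2
        + ∑ n ∈ Finset.range (m + 1), ‖waveMatrix ha k m n‖ ^ 2)) := by
  rw [structureFunction_laguerre ha]
  induction N with
  | zero => simp
  | succ N ih =>
    -- the matrix is symmetric, so its new row and its new column contribute equally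
    have hcol : ∑ m ∈ Finset.range N, ‖waveMatrix ha k m N‖ ^ 2 =
        ∑ n ∈ Finset.range N, ‖waveMatrix ha k N n‖ ^ 2 :=
      Finset.sum_congr rfl fun m _ => by rw [waveMatrix_comm]
    have hsum : ∑ m ∈ Finset.range (N + 1), ∑ n ∈ Finset.range (N + 1),
        ‖waveMatrix ha k m n‖ ^ 2 = ∑ m ∈ Finset.range N, ∑ n ∈ Finset.range N,
        ‖waveMatrix ha k m n‖ ^ 2 + ∑ n ∈ Finset.range N, ‖waveMatrix ha k N n‖ ^ 2
        + ∑ n ∈ Finset.range (N + 1), ‖waveMatrix ha k N n‖ ^ 2 := by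
      rw [Finset.sum_range_succ, Finset.sum_congr rfl fun m _ => Finset.sum_range_succ _ N,
        Finset.sum_add_distrib, hcol]
    rw [hsum, Finset.sum_range_succ (fun m => (1 : ℝ) - _), ← ih]
    push_cast
    ring

theorem tendsto_structureFunction_laguerre (ha : -1 < a) {k : ℝ} (hk : 0 ≤ k) :
    Tendsto (fun N : ℕ => structureFunction (laguerreWeight a) N k / (N : ℝ)) atTop
      (𝓝 (2 / Real.pi * Real.arctan k)) := by
  rcases hk.eq_or_lt with rfl | hk
  · have h0 (N : ℕ) : structureFunction (laguerreWeight a) N 0 = 0 := by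
      rw [structureFunction_laguerre ha, sub_eq_zero]
      have hrow : ∀ m ∈ Finset.range N,
          ∑ n ∈ Finset.range N, ‖waveMatrix ha 0 m n‖ ^ 2 = 1 := fun m hm => by
        rw [Finset.sum_eq_single_of_mem m hm fun n _ hn => by
          rw [waveMatrix_zero, if_neg hn.symm]; simp]
        simp [waveMatrix_zero]
      rw [Finset.sum_congr rfl hrow]
      simp
    simp [h0]
  · obtain ⟨h1, h2⟩ := tendsto_sum_row ha hk
    have h := ((tendsto_const_nhds (x := (1 : ℝ))).sub (h1.add h2)).cesaro
    have e : 1 - (1 / 2 - Real.arctan k / Real.pi + (1 / 2 - Real.arctan k / Real.pi)) =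
        2 / Real.pi * Real.arctan k := by ring
    rw [e] at h
    refine h.congr fun N => ?_
    rw [structureFunction_laguerre_eq_sum ha, inv_mul_eq_div]

end Limit

end RandomMatrix

theorem mainTheorem3 (a : ℝ) (ha : -1 < a) :
    (∀ N : ℕ,
      (∀ x, 0 ≤ RandomMatrix.jointDensity (RandomMatrix.laguerreWeight a) N x) ∧
      Integrable (RandomMatrix.jointDensity (RandomMatrix.laguerreWeight a) N) ∧
      ∫ x, RandomMatrix.jointDensity (RandomMatrix.laguerreWeight a) N x = 1) ∧
    ∃ S : ℝ → ℝ,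
      (∀ k : ℝ, 0 ≤ k →
        Tendsto
          (fun N : ℕ =>
            RandomMatrix.structureFunction (RandomMatrix.laguerreWeight a) N k / (N : ℝ))
          atTop (𝓝 (S k))) ∧
      (∀ k : ℝ, 0 ≤ k → S k = 2 / Real.pi * Real.arctan k) ∧
      AnalyticOnNhd ℝ S (Set.Ioi 0) ∧
      (∀ k : ℝ, 0 ≤ k → S k < 1) := by
  refine ⟨fun N => ⟨RandomMatrix.jointDensity_laguerre_nonneg ha N,
    RandomMatrix.integrable_jointDensity_laguerre ha N,
    RandomMatrix.integral_jointDensity_laguerre ha N⟩,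
    fun k => 2 / Real.pi * Real.arctan k,
    fun k hk => RandomMatrix.tendsto_structureFunction_laguerre ha hk, fun k _ => rfl,
    (contDiff_const.mul Real.contDiff_arctan).analyticOnNhd, fun k _ => ?_⟩
  have h := Real.arctan_lt_pi_div_two k
  change 2 / Real.pi * Real.arctan k < 1
  rw [div_mul_eq_mul_div, div_lt_one Real.pi_pos]
  linarith
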